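/- Let $A$ be a separable $C^*$-algebra and let $\tau$ be a densely defined, faithful, semifinite, lower semicontinuous, positive trace on $A$. Let $L^2(A,\tau)$ be the Hilbert space of its GNS representation $\pi_\tau$, $M=\pi_\tau(A)''$ the von Neumann algebra generated by $A$, $J$ the antilinear isometry of $L^2(A,\tau)$ extending $a\mapsto a^*$, and $L^2_+(A,\tau)$ the closure in $L^2(A,\tau)$ of the positive square-integrable elements of $A$. Square-integrable elements of $A$ and of $M$ are identified with their images in $L^2(A,\tau)$. Let $(\mathcal E,\mathcal F)$ be a $C^*$-Dirichlet form on $L^2(A,\tau)$, that is, a closed, densely defined, nonnegative quadratic form such that: (i) it is real, i.e. $J\xi\in\mathcal F$ and $\mathcal E[J\xi]=\mathcal E[\xi]$ for $\xi\in\mathcal F$; (ii) it is Markovian, i.e. for every $\xi=J\xi\in\mathcal F$ the projection $\xi\wedge 1$ of $\xi$ onto the $L^2$-closure of $\{a=a^*\in A\cap L^2(A,\tau): a\le 1\}$ lies in $\mathcal F$ and $\mathcal E[\xi\wedge1]\le\mathcal E[\xi]$; (iii) for all $n\ge1$ the extension $\mathcal E_n[(\xi_{ij})]=\sum_{i,j}\mathcal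 E[\xi_{ij}]$ to $M_n(\mathcal F)\subseteq L^2(M_n(A),\tau\otimes \mathrm{tr}_n)$ is real and Markovian in the same sense; (iv) it is regular, i.e. $\mathcal B:=A\cap\mathcal F$ is norm dense in $A$ and is a form core. Put $\langle\xi,\eta\rangle_{\mathcal F}=\mathcal E(\xi,\eta)+(\xi,\eta)_{L^2(A,\tau)}$ (linear in $\eta$) and $\|\xi\|_{\mathcal F}=\langle\xi,\xi\rangle_{\mathcal F}^{1/2}$. Let $\widetilde{\mathcal B}=\mathcal F\cap M$, and let the fine $C^*$-algebra $\mathcal C$ be the norm closure of $\widetilde{\mathcal B}$ in $M$. Let $\omega\in A^*_+$ be a finite-energy functional: a positive functional on $A$ for which there is $c\ge0$ with $\omega(b)\le c\,\|b\|_{\mathcal F}$ for all $b\in\mathcal B\cap L^2_+(A,\tau)$. Then there is a unique $G(\omega)\in\mathcal F$ (the potential of $\omega$) with $\omega(b)=\langle G(\omega),b\rangle_{\mathcal F}$ for all $b\in\mathcal B$. Moreover $A\subseteq\mathcal C$ (via $\pi_\tau$), and the linear map $$\widetilde\omega:\widetilde{\mathcal B}\to\mathbb C,\qquad \widetilde\omega(b)=\langle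 G(\omega),b\rangle_{\mathcal F},$$ extends to a bounded positive linear functional on $\mathcal C$, which restricts to $\omega$ on $A$ and whose norm is $\|\omega\|_{A^*}$. -/

import Mathlib

open scoped ENNReal ComplexOrder InnerProductSpace
open UniformSpace

noncomputable section

/-- A densely defined, faithful, semifinite, lower semicontinuous, positive trace on a
C⋆-algebra `A`: a map `τ : A₊ → [0, ∞]`. The values of `toFun` outside the positive cone
play no role. -/
structure CStarTrace (A : Type*) [NonUnitalCStarAlgebra A] [PartialOrder A]
    [StarOrderedRing A] where
  toFun : A → ℝ≥0∞
  map_add : ∀ a b : A, 0 ≤ a → 0 ≤ b → toFun (a + b) = toFun a + toFun b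
  map_smul : ∀ (r : ℝ) (a : A), 0 ≤ r → 0 ≤ a → toFun (r • a) = ENNReal.ofReal r * toFun a
  tracial : ∀ a : A, toFun (star a * a) = toFun (a * star a)
  faithful : ∀ a : A, 0 ≤ a → toFun a = 0 → a = 0
  lowerSemicontinuous : LowerSemicontinuousOn toFun {a : A | 0 ≤ a}
  denselyDefined : {a : A | 0 ≤ a} ⊆ closure {a : A | 0 ≤ a ∧ toFun a < ∞}
  semifinite : ∀ a : A, 0 ≤ a →
    IsLUB (toFun '' {b : A | 0 ≤ b ∧ b ≤ a ∧ toFun b < ∞}) (toFun a)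

namespace CStarTrace

variable {A : Type*} [NonUnitalCStarAlgebra A] [PartialOrder A] [StarOrderedRing A]
  (τ : CStarTrace A)

theorem map_zero : τ.toFun 0 = 0 := by
  have h := τ.map_smul 0 0 le_rfl le_rfl
  simpa using h

theorem mono {a b : A} (ha : 0 ≤ a) (hab : a ≤ b) : τ.toFun a ≤ τ.toFun b := by
  have h := τ.map_add a (b - a) ha (sub_nonneg.2 hab)
  rw [add_sub_cancel] at h
  rw [h]
  exact le_self_add

/-- `τ(a⋆ a)`. -/
def sq (a : A) : ℝ≥0∞ := τ.toFun (star a * a)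

theorem sq_smul (z : ℂ) (a : A) : τ.sq (z • a) = ENNReal.ofReal (‖z‖ ^ 2) * τ.sq a := by
  have h : star (z • a) * (z • a) = (‖z‖ ^ 2 : ℝ) • (star a * a) := by
    rw [star_smul, smul_mul_smul_comm, ← Complex.coe_smul]
    congr 1
    simpa using Complex.conj_mul' z
  unfold sq
  rw [h]
  exact τ.map_smul _ _ (by positivity) (star_mul_self_nonneg a)

theorem sq_parallelogram (a b : A) :
    τ.sq (a + b) + τ.sq (a - b) = τ.sq a + τ.sq a + (τ.sq b + τ.sq b) := by
  unfold sq
  have p := fun x : A => star_mul_self_nonneg x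
  rw [← τ.map_add _ _ (p _) (p _), ← τ.map_add _ _ (p _) (p _), ← τ.map_add _ _ (p _) (p _),
    ← τ.map_add _ _ (add_nonneg (p _) (p _)) (add_nonneg (p _) (p _))]
  congr 1
  simp only [star_add, star_sub, add_mul, mul_add, sub_mul, mul_sub]
  abel

theorem sq_star (a : A) : τ.sq (star a) = τ.sq a := by
  unfold sq
  rw [star_star, τ.tracial]

theorem sq_mul_left (x a : A) : τ.sq (x * a) ≤ ENNReal.ofReal (‖x‖ ^ 2) * τ.sq a := by
  have h : star (x * a) * (x * a) ≤ (‖x‖ ^ 2 : ℝ) • (star a * a) := by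
    have := CStarAlgebra.star_left_conjugate_le_norm_smul (a := a) (b := star x * x)
      (hb := IsSelfAdjoint.star_mul_self x)
    rw [CStarRing.norm_star_mul_self, ← pow_two] at this
    simpa [star_mul, mul_assoc] using this
  unfold sq
  rw [← τ.map_smul _ _ (by positivity) (star_mul_self_nonneg a)]
  exact τ.mono (star_mul_self_nonneg _) h

theorem sq_mul_right (a x : A) : τ.sq (a * x) ≤ ENNReal.ofReal (‖x‖ ^ 2) * τ.sq a := by
  rw [← τ.sq_star (a * x), star_mul, ← τ.sq_star a, ← norm_star x]
  exact τ.sq_mul_left _ _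

/-- The ideal `A ∩ L²(A, τ) = {a ∈ A : τ(a⋆ a) < ∞}` of square integrable elements. -/
def sqIntegrable : Submodule ℂ A where
  carrier := {a | τ.sq a < ∞}
  zero_mem' := by simp [sq, τ.map_zero]
  add_mem' {a b} ha hb := by
    have h := τ.sq_parallelogram a b
    have ha' : τ.sq a < ∞ := ha
    have hb' : τ.sq b < ∞ := hb
    refine lt_of_le_of_lt (le_self_add.trans h.le) ?_
    simp [ENNReal.add_lt_top, ha', hb']
  smul_mem' z a ha := by
    change τ.sq (z • a) < ∞
    rw [τ.sq_smul]
    exact ENNReal.mul_lt_top ENNReal.ofReal_lt_top ha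

/-- The square integrable elements of `A`, regarded as a pre-Hilbert space
for the inner product `⟪a, b⟫ = τ(a⋆ b)`. -/
def PreL2 : Type _ := τ.sqIntegrable

instance : AddCommGroup τ.PreL2 := inferInstanceAs (AddCommGroup τ.sqIntegrable)
instance : Module ℂ τ.PreL2 := inferInstanceAs (Module ℂ τ.sqIntegrable)

def toPreL2 : τ.sqIntegrable ≃ₗ[ℂ] τ.PreL2 := LinearEquiv.refl ℂ _

/-- The underlying element of `A`. -/
def val : τ.PreL2 →ₗ[ℂ] A := τ.sqIntegrable.subtype ∘ₗ τ.toPreL2.symm.toLinearMap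

theorem val_injective : Function.Injective τ.val := Subtype.val_injective

theorem sq_val_lt (a : τ.PreL2) : τ.sq (τ.val a) < ∞ := a.2

/-- `τ(a⋆ a)` as a real number. -/
def nsq (a : τ.PreL2) : ℝ := (τ.sq (τ.val a)).toReal

theorem nsq_nonneg (a : τ.PreL2) : 0 ≤ τ.nsq a := ENNReal.toReal_nonneg

theorem nsq_smul (z : ℂ) (a : τ.PreL2) : τ.nsq (z • a) = ‖z‖ ^ 2 * τ.nsq a := by
  unfold nsq
  rw [_root_.map_smul, τ.sq_smul, ENNReal.toReal_mul, ENNReal.toReal_ofReal (by positivity)]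

theorem nsq_neg (a : τ.PreL2) : τ.nsq (-a) = τ.nsq a := by
  simpa using τ.nsq_smul (-1) a

theorem nsq_I (a : τ.PreL2) : τ.nsq (Complex.I • a) = τ.nsq a := by
  simpa using τ.nsq_smul Complex.I a

/-- `2 (τ(a⋆ b) + τ(b⋆ a))`, as a difference of squares. -/
def pol (a b : τ.PreL2) : ℝ := τ.nsq (a + b) - τ.nsq (a - b)

theorem pol_comm (a b : τ.PreL2) : τ.pol a b = τ.pol b a := by
  unfold pol
  rw [add_comm, ← τ.nsq_neg (a - b), neg_sub]

theorem pol_neg_left (a b : τ.PreL2) : τ.pol (-a) b = -τ.pol a b := by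
  unfold pol
  rw [← τ.nsq_neg (-a + b), ← τ.nsq_neg (-a - b), show -(-a + b) = a - b by abel,
    show -(-a - b) = a + b by abel]
  ring

theorem pol_I_I (a b : τ.PreL2) : τ.pol (Complex.I • a) (Complex.I • b) = τ.pol a b := by
  unfold pol
  rw [← smul_add, ← smul_sub, τ.nsq_I, τ.nsq_I]

theorem pol_I_left (a b : τ.PreL2) : τ.pol (Complex.I • a) b = -τ.pol a (Complex.I • b) := by
  rw [← τ.pol_I_I, smul_smul, Complex.I_mul_I, neg_one_smul, pol_neg_left]

theorem pol_add_left (x y z : τ.PreL2) : τ.pol (x + y) z = τ.pol x z + τ.pol y z := by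
  have key : τ.sq (τ.val (x + y + z)) + (τ.sq (τ.val (x - z)) + τ.sq (τ.val (y - z))) =
      τ.sq (τ.val (x + y - z)) + (τ.sq (τ.val (x + z)) + τ.sq (τ.val (y + z))) := by
    unfold sq
    have p := fun x : A => star_mul_self_nonneg x
    rw [← τ.map_add _ _ (p _) (p _), ← τ.map_add _ _ (p _) (p _),
      ← τ.map_add _ _ (p _) (add_nonneg (p _) (p _)),
      ← τ.map_add _ _ (p _) (add_nonneg (p _) (p _))]
    congr 1
    simp only [_root_.map_add, map_sub, star_add, star_sub, add_mul, mul_add, sub_mul, mul_sub]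
    abel
  have f := fun a => (τ.sq_val_lt a).ne
  have key' := congrArg ENNReal.toReal key
  rw [ENNReal.toReal_add (f _) (ENNReal.add_ne_top.2 ⟨f _, f _⟩), ENNReal.toReal_add (f _) (f _),
    ENNReal.toReal_add (f _) (ENNReal.add_ne_top.2 ⟨f _, f _⟩),
    ENNReal.toReal_add (f _) (f _)] at key'
  unfold pol nsq
  linarith

theorem pol_smul_left_of_nonneg (r : ℝ) (hr : 0 ≤ r) (x y : τ.PreL2) :
    τ.pol ((r : ℂ) • x) y = r * τ.pol x y := by
  have key : τ.sq (τ.val ((r : ℂ) • x + y)) + ENNReal.ofReal r * τ.sq (τ.val (x - y)) =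
      τ.sq (τ.val ((r : ℂ) • x - y)) + ENNReal.ofReal r * τ.sq (τ.val (x + y)) := by
    unfold sq
    have p := fun x : A => star_mul_self_nonneg x
    rw [← τ.map_smul r _ hr (p _), ← τ.map_smul r _ hr (p _),
      ← τ.map_add _ _ (p _) (smul_nonneg hr (p _)),
      ← τ.map_add _ _ (p _) (smul_nonneg hr (p _))]
    congr 1
    have hv : τ.val ((r : ℂ) • x) = r • τ.val x := by
      rw [_root_.map_smul, Complex.coe_smul]
    simp only [_root_.map_add, map_sub, hv, star_add, star_sub,
      add_mul, mul_add, sub_mul, mul_sub, star_smul, smul_mul_assoc, mul_smul_comm, smul_add,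
      smul_sub, star_trivial]
    abel
  have f := fun a => (τ.sq_val_lt a).ne
  have g := fun a => ENNReal.mul_ne_top (ENNReal.ofReal_ne_top (r := r)) (f a)
  have key' := congrArg ENNReal.toReal key
  rw [ENNReal.toReal_add (f _) (g _), ENNReal.toReal_add (f _) (g _), ENNReal.toReal_mul,
    ENNReal.toReal_mul, ENNReal.toReal_ofReal hr] at key'
  unfold pol nsq
  linarith

theorem pol_smul_left (r : ℝ) (x y : τ.PreL2) :
    τ.pol ((r : ℂ) • x) y = r * τ.pol x y := by
  rcases le_total 0 r with hr | hr
  · exact τ.pol_smul_left_of_nonneg r hr x y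
  · have h := τ.pol_smul_left_of_nonneg (-r) (neg_nonneg.2 hr) x y
    rw [Complex.ofReal_neg, neg_smul, pol_neg_left] at h
    linarith

/-- The inner product `τ(a⋆ b)` of two square integrable elements, obtained from
`τ(a⋆ a)` by polarization. -/
def inn (a b : τ.PreL2) : ℂ :=
  ((τ.pol a b : ℂ) - Complex.I * (τ.pol a (Complex.I • b) : ℂ)) / 4

theorem inn_add_left (x y z : τ.PreL2) : τ.inn (x + y) z = τ.inn x z + τ.inn y z := by
  unfold inn
  rw [pol_add_left, pol_add_left]
  push_cast
  ring

theorem inn_real_smul_left (r : ℝ) (x y : τ.PreL2) :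
    τ.inn ((r : ℂ) • x) y = r * τ.inn x y := by
  unfold inn
  rw [pol_smul_left, pol_smul_left]
  push_cast
  ring

theorem inn_I_smul_left (x y : τ.PreL2) :
    τ.inn (Complex.I • x) y = -Complex.I * τ.inn x y := by
  unfold inn
  rw [pol_I_I, pol_I_left]
  push_cast
  linear_combination (-(τ.pol x (Complex.I • y) : ℂ) / 4) * Complex.I_sq

theorem inn_self (x : τ.PreL2) : τ.inn x x = τ.nsq x := by
  have h1 : τ.pol x x = 4 * τ.nsq x := by
    unfold pol
    have h0 : τ.nsq 0 = 0 := by simpa using τ.nsq_smul 0 0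
    have h2 := τ.nsq_smul 2 x
    rw [two_smul] at h2
    rw [h2, sub_self, h0]
    norm_num
  have h2 : τ.pol x (Complex.I • x) = 0 := by
    have h := τ.pol_I_left x x
    rw [τ.pol_comm (Complex.I • x) x] at h
    linarith
  unfold inn
  rw [h1, h2]
  push_cast
  ring

/-- The pre-Hilbert space structure on the square integrable elements. -/
@[reducible]
def core : InnerProductSpace.Core ℂ τ.PreL2 where
  inner a b := τ.inn a b
  conj_inner_symm a b := by
    unfold inn
    have h : τ.pol b (Complex.I • a) = -τ.pol a (Complex.I • b) := by
      rw [τ.pol_comm, τ.pol_I_left]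
    rw [h, τ.pol_comm b a, map_div₀, map_ofNat]
    simp [sub_eq_add_neg]
  re_inner_nonneg a := by
    rw [inn_self]
    simpa using τ.nsq_nonneg a
  add_left := τ.inn_add_left
  smul_left x y z := by
    have hz : z • x = (z.re : ℂ) • x + (z.im : ℂ) • (Complex.I • x) := by
      rw [smul_smul, ← add_smul, Complex.re_add_im]
    have hz' : (starRingEnd ℂ) z = (z.re : ℂ) - z.im * Complex.I := by
      apply Complex.ext <;> simp
    rw [hz, hz', inn_add_left, inn_real_smul_left, inn_real_smul_left, inn_I_smul_left]
    ring
  definite x hx := by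
    rw [inn_self] at hx
    have h0 : τ.nsq x = 0 := by exact_mod_cast hx
    have h1 : τ.sq (τ.val x) = 0 := by
      rcases (ENNReal.toReal_eq_zero_iff _).1 h0 with h | h
      · exact h
      · exact absurd h (τ.sq_val_lt x).ne
    have h2 := τ.faithful _ (star_mul_self_nonneg _) h1
    apply τ.val_injective
    rw [_root_.map_zero]
    exact CStarRing.star_mul_self_eq_zero_iff _ |>.1 h2

instance : NormedAddCommGroup τ.PreL2 := τ.core.toNormedAddCommGroup
instance : InnerProductSpace ℂ τ.PreL2 := InnerProductSpace.ofCore τ.core.toCore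

theorem norm_sq_preL2 (a : τ.PreL2) : ‖a‖ ^ 2 = τ.nsq a := by
  rw [← inner_self_eq_norm_sq (𝕜 := ℂ) a]
  change RCLike.re (τ.inn a a) = _
  rw [inn_self]
  simp

/-- The Hilbert space `L²(A, τ)` of the GNS representation. -/
def L2 : Type _ := Completion τ.PreL2

instance : NormedAddCommGroup τ.L2 := inferInstanceAs (NormedAddCommGroup (Completion τ.PreL2))
instance : InnerProductSpace ℂ τ.L2 := inferInstanceAs (InnerProductSpace ℂ (Completion τ.PreL2))
instance : CompleteSpace τ.L2 := inferInstanceAs (CompleteSpace (Completion τ.PreL2))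

/-- The canonical image in `L²(A, τ)` of a square integrable element of `A`. -/
def toL2 : τ.sqIntegrable →ₗ[ℂ] τ.L2 :=
  (Completion.toComplL (𝕜 := ℂ) (E := τ.PreL2)).toLinearMap ∘ₗ τ.toPreL2.toLinearMap

theorem denseRange_toL2 : DenseRange τ.toL2 :=
  Completion.denseRange_coe (α := τ.PreL2)

theorem mul_left_mem (x : A) (a : τ.PreL2) : x * τ.val a ∈ τ.sqIntegrable :=
  lt_of_le_of_lt (τ.sq_mul_left x _) (ENNReal.mul_lt_top ENNReal.ofReal_lt_top (τ.sq_val_lt a))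

theorem mul_right_mem (x : A) (a : τ.PreL2) : τ.val a * x ∈ τ.sqIntegrable :=
  lt_of_le_of_lt (τ.sq_mul_right _ x) (ENNReal.mul_lt_top ENNReal.ofReal_lt_top (τ.sq_val_lt a))

theorem star_mem (a : τ.PreL2) : star (τ.val a) ∈ τ.sqIntegrable := by
  change τ.sq (star (τ.val a)) < ∞
  rw [sq_star]
  exact τ.sq_val_lt a

theorem norm_le_of_sq_le {a b : τ.PreL2} {c : ℝ} (hc : 0 ≤ c)
    (h : τ.sq (τ.val a) ≤ ENNReal.ofReal (c ^ 2) * τ.sq (τ.val b)) : ‖a‖ ≤ c * ‖b‖ := by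
  rw [← sq_le_sq₀ (norm_nonneg _) (by positivity), mul_pow, norm_sq_preL2, norm_sq_preL2]
  have := ENNReal.toReal_mono (ENNReal.mul_ne_top ENNReal.ofReal_ne_top (τ.sq_val_lt b).ne) h
  rwa [ENNReal.toReal_mul, ENNReal.toReal_ofReal (by positivity)] at this

/-- Left multiplication by `x` on the square integrable elements. -/
def preLeft (x : A) : τ.PreL2 →L[ℂ] τ.PreL2 :=
  LinearMap.mkContinuous
    { toFun := fun a => τ.toPreL2 ⟨x * τ.val a, τ.mul_left_mem x a⟩
      map_add' := fun a b => τ.val_injective (by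
        change x * τ.val (a + b) = x * τ.val a + x * τ.val b
        rw [_root_.map_add, mul_add])
      map_smul' := fun z a => τ.val_injective (by
        change x * τ.val (z • a) = z • (x * τ.val a)
        rw [_root_.map_smul, mul_smul_comm]) }
    ‖x‖ (fun a => τ.norm_le_of_sq_le (norm_nonneg x) (τ.sq_mul_left x _))

/-- Right multiplication by `x` on the square integrable elements. -/
def preRight (x : A) : τ.PreL2 →L[ℂ] τ.PreL2 :=
  LinearMap.mkContinuous
    { toFun := fun a => τ.toPreL2 ⟨τ.val a * x, τ.mul_right_mem x a⟩
      map_add' := fun a b => τ.val_injective (by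
        change τ.val (a + b) * x = τ.val a * x + τ.val b * x
        rw [_root_.map_add, add_mul])
      map_smul' := fun z a => τ.val_injective (by
        change τ.val (z • a) * x = z • (τ.val a * x)
        rw [_root_.map_smul, smul_mul_assoc]) }
    ‖x‖ (fun a => τ.norm_le_of_sq_le (norm_nonneg x) (τ.sq_mul_right _ x))

/-- The involution on the square integrable elements. -/
def preStar : τ.PreL2 →SL[starRingEnd ℂ] τ.PreL2 :=
  LinearMap.mkContinuous
    { toFun := fun a => τ.toPreL2 ⟨star (τ.val a), τ.star_mem a⟩
      map_add' := fun a b => τ.val_injective (by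
        change star (τ.val (a + b)) = star (τ.val a) + star (τ.val b)
        rw [_root_.map_add, star_add])
      map_smul' := fun z a => τ.val_injective (by
        change star (τ.val (z • a)) = star z • star (τ.val a)
        rw [_root_.map_smul, star_smul]) }
    1 (fun a => τ.norm_le_of_sq_le zero_le_one (by
        change τ.sq (star (τ.val a)) ≤ _
        rw [sq_star]
        simp))

/-- The GNS representation `π_τ(x)`: the bounded operator on `L²(A, τ)` extending `a ↦ x a`. -/
def gns (x : A) : τ.L2 →L[ℂ] τ.L2 := (τ.preLeft x).completion

/-- The bounded operator on `L²(A, τ)` extending the right multiplication `a ↦ a x`. -/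
def rightMul (x : A) : τ.L2 →L[ℂ] τ.L2 := (τ.preRight x).completion

/-- The modular conjugation `J` on `L²(A, τ)`: the antilinear isometry extending `a ↦ a⋆`. -/
def conj : τ.L2 →SL[starRingEnd ℂ] τ.L2 := τ.preStar.completion

theorem gns_toL2 (x : A) (a : τ.sqIntegrable) :
    τ.gns x (τ.toL2 a) = τ.toL2 ⟨x * a, τ.mul_left_mem x (τ.toPreL2 a)⟩ :=
  (τ.preLeft x).completion_apply_coe _

theorem rightMul_toL2 (x : A) (a : τ.sqIntegrable) :
    τ.rightMul x (τ.toL2 a) = τ.toL2 ⟨a * x, τ.mul_right_mem x (τ.toPreL2 a)⟩ :=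
  (τ.preRight x).completion_apply_coe _

theorem conj_toL2 (a : τ.sqIntegrable) :
    τ.conj (τ.toL2 a) = τ.toL2 ⟨star (a : A), τ.star_mem (τ.toPreL2 a)⟩ :=
  τ.preStar.completion_apply_coe _

theorem norm_sq_toL2 (a : τ.sqIntegrable) :
    ‖τ.toL2 a‖ ^ 2 = (τ.toFun (star (a : A) * a)).toReal :=
  (congrArg (fun r : ℝ => r ^ 2) (Completion.norm_coe (τ.toPreL2 a))).trans
    (τ.norm_sq_preL2 (τ.toPreL2 a))

/-- The von Neumann algebra `M = π_τ(A)''`, the bicommutant of the GNS representation. -/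
def vonNeumann : StarSubalgebra ℂ (τ.L2 →L[ℂ] τ.L2) :=
  StarSubalgebra.centralizer ℂ
    (StarSubalgebra.centralizer ℂ (Set.range τ.gns) : Set (τ.L2 →L[ℂ] τ.L2))

/-- The standard cone `L²₊(A, τ)`: the closure of the positive square integrable elements. -/
def L2pos : Set τ.L2 := closure (τ.toL2 '' {a : τ.sqIntegrable | 0 ≤ (a : A)})

/-- `x ∈ M` is square integrable (for the canonical normal extension of `τ` to `M`) with
canonical image `ξ` in `L²(A, τ)`. In terms of the left Hilbert algebra of square integrable
elements: `x` is the operator of left multiplication by `ξ`, that is, `x b = ξ b` for all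
square integrable `b`. The canonical trace on `M` is then `τ(x⋆ x) = ‖ξ‖²`. -/
def Represents (x : τ.L2 →L[ℂ] τ.L2) (ξ : τ.L2) : Prop :=
  x ∈ τ.vonNeumann ∧ ∀ b : τ.sqIntegrable, x (τ.toL2 b) = τ.rightMul (b : A) ξ

/-- The closed convex set `{ξ ∈ L²_h(A, τ) : ξ ≤ 1}`: the `L²`-closure of
`{a ∈ A ∩ L²(A, τ) : a = a⋆, a ≤ 1}`. For self-adjoint `a` in a C⋆-algebra which may fail to be
unital, `a ≤ 1` means that the spectrum of `a` in the unitization is contained in `(-∞, 1]`. -/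
def leOne : Set τ.L2 :=
  closure (τ.toL2 '' {a : τ.sqIntegrable |
    IsSelfAdjoint (a : A) ∧ quasispectrum ℝ (a : A) ⊆ Set.Iic 1})

/-- The Hilbert space `L²(M_n(A), τ_n) = M_n(L²(A, τ))`. The norm used here is that of the
unnormalized trace `τ ⊗ Tr`; normalizing the trace multiplies the norm by the constant `n^(-1/2)`,
which changes neither the topology nor the projections onto closed convex sets. -/
abbrev L2Mat (n : ℕ) : Type _ := PiLp 2 (fun _ : Fin n × Fin n => τ.L2)

/-- The `L²`-closure of `{a ∈ M_n(A) ∩ L²(M_n(A), τ_n) : a = a⋆, a ≤ 1}`. -/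
def leOneMat (n : ℕ) : Set (τ.L2Mat n) :=
  closure {ξ | ∃ a : CStarMatrix (Fin n) (Fin n) A, ∃ h : ∀ i j, a i j ∈ τ.sqIntegrable,
    IsSelfAdjoint a ∧ quasispectrum ℝ a ⊆ Set.Iic 1 ∧
      ∀ i j, ξ (i, j) = τ.toL2 ⟨a i j, h i j⟩}

end CStarTrace

/-- `p` is the (Hilbert) projection of `ξ` onto the closed convex set `C`. -/
def IsHilbertProjection {H : Type*} [NormedAddCommGroup H] (C : Set H) (ξ p : H) : Prop :=
  p ∈ C ∧ ∀ c ∈ C, ‖ξ - p‖ ≤ ‖ξ - c‖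

/-- A closed, densely defined, nonnegative quadratic form `(E, F)` on a complex Hilbert space,
given by its sesquilinear form `E(ξ, η)`, linear in the second variable. -/
structure ClosedForm (H : Type*) [NormedAddCommGroup H] [InnerProductSpace ℂ H] where
  domain : Submodule ℂ H
  form : domain →ₗ⋆[ℂ] domain →ₗ[ℂ] ℂ
  hermitian : ∀ ξ η, form η ξ = starRingEnd ℂ (form ξ η)
  nonneg : ∀ ξ, 0 ≤ (form ξ ξ).re
  dense : Dense (domain : Set H)
  closed : ∀ u : ℕ → domain,
    (∀ ε > 0, ∃ N, ∀ m ≥ N, ∀ n ≥ N,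
      (form (u m - u n) (u m - u n)).re + ‖(u m : H) - u n‖ ^ 2 < ε) →
    ∃ ξ : domain, ∀ ε > 0, ∃ N, ∀ n ≥ N,
      (form (u n - ξ) (u n - ξ)).re + ‖(u n : H) - ξ‖ ^ 2 < ε

namespace ClosedForm

variable {H : Type*} [NormedAddCommGroup H] [InnerProductSpace ℂ H] (E : ClosedForm H)

/-- The quadratic form `E[ξ] = E(ξ, ξ)`. -/
def energy (ξ : E.domain) : ℝ := (E.form ξ ξ).re

/-- The scalar product `⟨ξ, η⟩_F = E(ξ, η) + (ξ, η)` of the Dirichlet space. -/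
def innerF (ξ η : E.domain) : ℂ := E.form ξ η + ⟪(ξ : H), (η : H)⟫_ℂ

/-- The graph norm `‖ξ‖_F = (E[ξ] + ‖ξ‖²)^(1/2)` of the Dirichlet space. -/
def normF (ξ : E.domain) : ℝ := Real.sqrt (E.energy ξ + ‖(ξ : H)‖ ^ 2)

end ClosedForm

section Dirichlet

variable {A : Type*} [NonUnitalCStarAlgebra A] [PartialOrder A] [StarOrderedRing A]

/-- The form is real: `J ξ ∈ F` and `E[J ξ] = E[ξ]` for `ξ ∈ F`. -/
def IsRealForm (τ : CStarTrace A) (E : ClosedForm τ.L2) : Prop :=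
  ∀ ξ : E.domain, ∃ h : τ.conj ξ ∈ E.domain, E.energy ⟨τ.conj ξ, h⟩ = E.energy ξ

/-- The form is Markovian: `ξ ∧ 1 ∈ F` and `E[ξ ∧ 1] ≤ E[ξ]` for real `ξ ∈ F`, where `ξ ∧ 1` is
the projection of `ξ` onto `leOne`. -/
def IsMarkovianForm (τ : CStarTrace A) (E : ClosedForm τ.L2) : Prop :=
  ∀ ξ : E.domain, τ.conj ξ = ξ → ∀ p : τ.L2, IsHilbertProjection τ.leOne (ξ : τ.L2) p →
    ∃ h : p ∈ E.domain, E.energy ⟨p, h⟩ ≤ E.energy ξ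

/-- For every `n ≥ 1` the extension `E_n[(ξ_ij)] = ∑ E[ξ_ij]` on `M_n(F)` is Markovian on
`L²(M_n(A), τ_n)`. The conjugation of the latter space is `(ξ_ij) ↦ (J ξ_ji)`; for a real form `E`
the form `E_n` is automatically real, and it inherits closedness and density from `E`. -/
def IsCompletelyMarkovianForm (τ : CStarTrace A) (E : ClosedForm τ.L2) : Prop :=
  ∀ n : ℕ, 1 ≤ n → ∀ ξ : Fin n × Fin n → E.domain,
    (∀ i j, τ.conj (ξ (j, i)) = ξ (i, j)) →
    ∀ p : τ.L2Mat n,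
      IsHilbertProjection (τ.leOneMat n) (WithLp.toLp 2 fun k => (ξ k : τ.L2)) p →
      ∃ h : ∀ k, p k ∈ E.domain, ∑ k, E.energy ⟨p k, h k⟩ ≤ ∑ k, E.energy (ξ k)

/-- The Dirichlet algebra `B = A ∩ F`. -/
def dirichletAlgebra (τ : CStarTrace A) (E : ClosedForm τ.L2) : Submodule ℂ A :=
  (E.domain.comap τ.toL2).map τ.sqIntegrable.subtype

/-- The form is regular: `B = A ∩ F` is norm dense in `A` and a form core, that is,
dense in `F` for the graph norm. -/
def IsRegularForm (τ : CStarTrace A) (E : ClosedForm τ.L2) : Prop :=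
  Dense (dirichletAlgebra τ E : Set A) ∧
  ∀ ξ : E.domain, ∀ ε > 0, ∃ b : τ.sqIntegrable, ∃ hb : τ.toL2 b ∈ E.domain,
    E.normF (ξ - ⟨τ.toL2 b, hb⟩) < ε

/-- A C⋆-Dirichlet form on `L²(A, τ)`: a closed, densely defined, nonnegative quadratic form
which is real, Markovian, completely Markovian and regular. -/
structure CStarDirichletForm (τ : CStarTrace A) extends ClosedForm τ.L2 where
  real : IsRealForm τ toClosedForm
  markovian : IsMarkovianForm τ toClosedForm
  completelyMarkovian : IsCompletelyMarkovianForm τ toClosedForm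
  regular : IsRegularForm τ toClosedForm

namespace CStarDirichletForm

variable {τ : CStarTrace A} (D : CStarDirichletForm τ)

/-- The extended Dirichlet algebra `B̃ = F ∩ M`: the square integrable elements of `M` whose
canonical image in `L²(A, τ)` belongs to `F`. -/
def extendedAlgebra : Submodule ℂ (τ.L2 →L[ℂ] τ.L2) where
  carrier := {x | ∃ ξ ∈ D.domain, τ.Represents x ξ}
  zero_mem' := ⟨0, zero_mem _, zero_mem _, fun b => by simp⟩
  add_mem' := by
    rintro x y ⟨ξ, hξ, hx, hxξ⟩ ⟨η, hη, hy, hyη⟩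
    exact ⟨ξ + η, add_mem hξ hη, add_mem hx hy, fun b => by simp [hxξ, hyη]⟩
  smul_mem' := by
    rintro z x ⟨ξ, hξ, hx, hxξ⟩
    exact ⟨z • ξ, D.domain.smul_mem z hξ, τ.vonNeumann.smul_mem hx z, fun b => by simp [hxξ]⟩

/-- The fine C⋆-algebra: the norm closure of the extended Dirichlet algebra in `M`, with the
operator norm. Its positive elements are those which are positive operators. -/
def fine : Submodule ℂ (τ.L2 →L[ℂ] τ.L2) := D.extendedAlgebra.topologicalClosure

/-- `ω ∈ A⋆₊` is a finite-energy functional: it is positive and there is `c ≥ 0` with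
`ω(b) ≤ c ‖b‖_F` for all `b ∈ B₊ = B ∩ L²₊(A, τ)` (for which `ω(b)` is a real number). -/
def IsFiniteEnergy (ω : StrongDual ℂ A) : Prop :=
  (∀ a : A, 0 ≤ a → 0 ≤ ω a) ∧
  ∃ c : ℝ, 0 ≤ c ∧ ∀ (b : τ.sqIntegrable) (hb : τ.toL2 b ∈ D.domain), τ.toL2 b ∈ τ.L2pos →
    (ω b).re ≤ c * D.normF ⟨τ.toL2 b, hb⟩

/-- `G` is the potential of `ω`: `ω(b) = ⟨G, b⟩_F` for all `b ∈ B`. -/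
def IsPotentialOf (ω : StrongDual ℂ A) (G : D.domain) : Prop :=
  ∀ (b : τ.sqIntegrable) (hb : τ.toL2 b ∈ D.domain), ω b = D.innerF G ⟨τ.toL2 b, hb⟩

end CStarDirichletForm

end Dirichlet

end

/-! Everything rests on truncation. For self-adjoint `b` in B and `r > 0`, functional calculus
splits `b = b ∧ r + (b - r)₊` inside A. After rescaling to `r = 1`, the element `b ∧ r` computed in
A is the Hilbert projection of the Markov property (`isHilbertProjection_truncAbove`), so its graph
norm is at most that of `b` (`exists_normF_truncAbove_le`).

Potential: `ω(b ∧ r) ≤ r‖ω‖` becomes negligible as `r → 0`, while `(b - r)₊` is positive with graph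
norm at most `2‖b‖_F`. Finite energy therefore gives `|ω(b)| ≤ 2c‖b‖_F` on all of B
(`exists_bound`); the Riesz theorem yields `G`, and the core property makes it unique.

Extension: the main estimate (`IsPotentialOf.im_eq_zero_and_re_le`) says that if a self-adjoint `x`
in B̃ with vector `ξ` satisfies `x ≤ r`, then `⟨G, ξ⟩_F` is real and at most `r‖ω‖`. Approximate `ξ`
in graph norm by self-adjoint `bₙ` in B and replace these by `bₙ ∧ r`. They stay bounded in F, and
truncation moves `bₙ` by at most `‖bₙ - ξ‖` because `ξ` lies below `r` (`norm_excess_le`). Hence `bₙ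
∧ r → ξ` in L², so weakly in F (`tendsto_innerF`), and `⟨G, bₙ ∧ r⟩_F = ω(bₙ ∧ r) ≤ r‖ω‖`.

Taking `r` close to `‖x‖` bounds the functional by `‖ω‖`. Taking `r` small, for self-adjoint
elements close to `-x` with `x ≥ 0`, gives positivity. Density of B in A shows that the extension
restricts to `ω`, and contractivity of `π_τ` gives the reverse norm inequality. -/

noncomputable section

/-! ### Conjugation, left and right multiplication on L². -/

namespace CStarTrace

variable {A : Type*} [NonUnitalCStarAlgebra A] [PartialOrder A] [StarOrderedRing A]
  (τ : CStarTrace A)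

theorem inner_toL2 (a b : τ.sqIntegrable) :
    ⟪τ.toL2 a, τ.toL2 b⟫_ℂ = τ.inn (τ.toPreL2 a) (τ.toPreL2 b) :=
  Completion.inner_coe (τ.toPreL2 a) (τ.toPreL2 b)

/-- The trace is additive only on the positive cone, so the identity is arranged as an equality of
sums of squares: the cross terms `b⋆xa` and `a⋆x⋆b` agree on both sides. -/
theorem pol_mul_left (x : A) (a b : τ.PreL2) :
    τ.pol (τ.preLeft x a) b = τ.pol a (τ.preLeft (star x) b) := by
  have hv : ∀ y c, τ.val (τ.preLeft y c) = y * τ.val c := fun _ _ => rfl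
  have key : τ.sq (τ.val (τ.preLeft x a + b)) + τ.sq (τ.val (a - τ.preLeft (star x) b)) =
      τ.sq (τ.val (τ.preLeft x a - b)) + τ.sq (τ.val (a + τ.preLeft (star x) b)) := by
    unfold sq
    have p := fun x : A => star_mul_self_nonneg x
    rw [← τ.map_add _ _ (p _) (p _), ← τ.map_add _ _ (p _) (p _)]
    congr 1
    simp only [_root_.map_add, map_sub, hv, star_add, star_sub, add_mul, mul_add, sub_mul, mul_sub,
      star_mul, star_star, mul_assoc]
    abel
  have f := fun a => (τ.sq_val_lt a).ne
  have key' := congrArg ENNReal.toReal key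
  rw [ENNReal.toReal_add (f _) (f _), ENNReal.toReal_add (f _) (f _)] at key'
  unfold pol nsq
  linarith

theorem inn_mul_left (x : A) (a b : τ.PreL2) :
    τ.inn (τ.preLeft x a) b = τ.inn a (τ.preLeft (star x) b) := by
  unfold inn
  rw [pol_mul_left, pol_mul_left, _root_.map_smul]

theorem pol_star (a b : τ.PreL2) : τ.pol (τ.preStar a) (τ.preStar b) = τ.pol a b := by
  have h : ∀ c, τ.nsq (τ.preStar c) = τ.nsq c := fun c => by
    unfold nsq
    exact congrArg _ (τ.sq_star (τ.val c))
  unfold pol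
  rw [← _root_.map_add, ← map_sub, h, h]

theorem inn_star (a b : τ.PreL2) : τ.inn (τ.preStar a) (τ.preStar b) = τ.inn b a := by
  have h : Complex.I • τ.preStar b = τ.preStar (-(Complex.I • b)) := by
    rw [map_neg, map_smulₛₗ]
    simp
  unfold inn
  rw [h, pol_star, pol_star, pol_comm, pol_comm _ a, pol_neg_left, pol_I_left, neg_neg]

theorem conj_conj (ξ : τ.L2) : τ.conj (τ.conj ξ) = ξ := by
  refine τ.denseRange_toL2.induction_on ξ
    (isClosed_eq (τ.conj.continuous.comp τ.conj.continuous) continuous_id) fun a => ?_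
  rw [conj_toL2, conj_toL2]
  exact congrArg _ (Subtype.ext (star_star _))

theorem inner_conj_conj (ξ η : τ.L2) : ⟪τ.conj ξ, τ.conj η⟫_ℂ = ⟪η, ξ⟫_ℂ := by
  refine τ.denseRange_toL2.induction_on₂ (p := fun ξ η => ⟪τ.conj ξ, τ.conj η⟫_ℂ = ⟪η, ξ⟫_ℂ)
    (isClosed_eq ?_ ?_) (fun a b => ?_) ξ η
  · exact (τ.conj.continuous.comp continuous_fst).inner (τ.conj.continuous.comp continuous_snd)
  · exact continuous_snd.inner continuous_fst
  · rw [conj_toL2, conj_toL2, inner_toL2, inner_toL2]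
    exact τ.inn_star (τ.toPreL2 a) (τ.toPreL2 b)

theorem inner_conj_left (ξ η : τ.L2) : ⟪τ.conj ξ, η⟫_ℂ = ⟪τ.conj η, ξ⟫_ℂ := by
  rw [← inner_conj_conj, conj_conj]

theorem norm_conj (ξ : τ.L2) : ‖τ.conj ξ‖ = ‖ξ‖ := by
  rw [← sq_eq_sq₀ (norm_nonneg _) (norm_nonneg _), ← inner_self_eq_norm_sq (𝕜 := ℂ),
    ← inner_self_eq_norm_sq (𝕜 := ℂ), inner_conj_conj]

theorem inner_gns_left (x : A) (ξ η : τ.L2) : ⟪τ.gns x ξ, η⟫_ℂ = ⟪ξ, τ.gns (star x) η⟫_ℂ := by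
  refine τ.denseRange_toL2.induction_on₂
    (p := fun ξ η => ⟪τ.gns x ξ, η⟫_ℂ = ⟪ξ, τ.gns (star x) η⟫_ℂ)
    (isClosed_eq ?_ ?_) (fun a b => ?_) ξ η
  · exact ((τ.gns x).continuous.comp continuous_fst).inner continuous_snd
  · exact continuous_fst.inner ((τ.gns (star x)).continuous.comp continuous_snd)
  · rw [gns_toL2, gns_toL2, inner_toL2, inner_toL2]
    exact τ.inn_mul_left x (τ.toPreL2 a) (τ.toPreL2 b)

/-- Transfers the adjoint relation from left to right multiplications. -/
theorem rightMul_eq_conj_gns (x : A) (ξ : τ.L2) :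
    τ.rightMul x ξ = τ.conj (τ.gns (star x) (τ.conj ξ)) := by
  refine τ.denseRange_toL2.induction_on ξ (isClosed_eq (τ.rightMul x).continuous
    (τ.conj.continuous.comp ((τ.gns _).continuous.comp τ.conj.continuous))) fun a => ?_
  rw [rightMul_toL2, conj_toL2, gns_toL2, conj_toL2]
  exact congrArg _ (Subtype.ext (by simp))

theorem inner_rightMul_left (x : A) (ξ η : τ.L2) :
    ⟪τ.rightMul x ξ, η⟫_ℂ = ⟪ξ, τ.rightMul (star x) η⟫_ℂ := by
  rw [rightMul_eq_conj_gns, rightMul_eq_conj_gns, inner_conj_left, star_star,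
    ← inner_conj_symm ξ,
    inner_conj_left _ (τ.gns x _), inner_conj_symm, inner_gns_left]

theorem gns_rightMul_toL2 (a b : τ.sqIntegrable) :
    τ.gns (a : A) (τ.toL2 b) = τ.rightMul (b : A) (τ.toL2 a) := by
  rw [gns_toL2, rightMul_toL2]

theorem norm_gns_apply_le (x : A) (ξ : τ.L2) : ‖τ.gns x ξ‖ ≤ ‖x‖ * ‖ξ‖ := by
  refine τ.denseRange_toL2.induction_on ξ (isClosed_le (τ.gns x).continuous.norm
    (continuous_const.mul continuous_norm)) fun a => ?_
  rw [gns_toL2]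
  exact (Completion.norm_coe _).trans_le ((τ.norm_le_of_sq_le (norm_nonneg x)
    (τ.sq_mul_left x (τ.val (τ.toPreL2 a)))).trans_eq
      (congrArg _ (Completion.norm_coe (τ.toPreL2 a)).symm))

theorem norm_gns_le (x : A) : ‖τ.gns x‖ ≤ ‖x‖ :=
  ContinuousLinearMap.opNorm_le_bound _ (norm_nonneg _) (τ.norm_gns_apply_le x)

theorem gns_sub (x y : A) : τ.gns (x - y) = τ.gns x - τ.gns y := by
  ext ξ
  refine τ.denseRange_toL2.induction_on ξ (isClosed_eq (τ.gns _).continuous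
    (τ.gns x - τ.gns y).continuous) fun a => ?_
  rw [sub_apply, gns_toL2, gns_toL2, gns_toL2, ← map_sub]
  exact congrArg _ (Subtype.ext (sub_mul _ _ _))

theorem gns_mem_vonNeumann (x : A) : τ.gns x ∈ τ.vonNeumann := by
  rw [vonNeumann, StarSubalgebra.mem_centralizer_iff]
  intro g hg
  have h := (StarSubalgebra.mem_centralizer_iff ℂ).1 hg (τ.gns x) ⟨x, rfl⟩
  have h' := (StarSubalgebra.mem_centralizer_iff ℂ).1 (StarMemClass.star_mem (SetLike.mem_coe.1 hg)) (τ.gns x) ⟨x, rfl⟩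
  exact ⟨h.1.symm, h'.1.symm⟩

theorem represents_gns (a : τ.sqIntegrable) : τ.Represents (τ.gns (a : A)) (τ.toL2 a) :=
  ⟨τ.gns_mem_vonNeumann _, fun b => τ.gns_rightMul_toL2 a b⟩

theorem toL2_injective : Function.Injective τ.toL2 := fun _ _ h =>
  τ.toPreL2.injective (Completion.coe_injective τ.PreL2 h)

variable {τ} in
-- Together with uniqueness of the vector, this shows that the vector of a self-adjoint operator is
-- fixed by `J`.
theorem Represents.adjoint {x : τ.L2 →L[ℂ] τ.L2} {ξ : τ.L2} (h : τ.Represents x ξ) :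
    τ.Represents (star x) (τ.conj ξ) := by
  refine ⟨StarMemClass.star_mem h.1, fun b => ?_⟩
  refine τ.denseRange_toL2.eq_of_inner_right (𝕜 := ℂ) fun c => ?_
  rw [ContinuousLinearMap.star_eq_adjoint, ContinuousLinearMap.adjoint_inner_right, h.2,
    inner_rightMul_left, ← inner_conj_symm (τ.toL2 c), inner_rightMul_left, inner_conj_left,
    inner_conj_symm]
  congr 1
  have h1 := τ.rightMul_toL2 (star (b : A)) c
  rw [h1, conj_toL2, rightMul_toL2]
  exact congrArg _ (Subtype.ext (by simp))

variable {τ} in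
theorem Represents.smul {x : τ.L2 →L[ℂ] τ.L2} {ξ : τ.L2} (h : τ.Represents x ξ) (z : ℂ) :
    τ.Represents (z • x) (z • ξ) :=
  ⟨τ.vonNeumann.smul_mem h.1 z, fun b => by simp [h.2]⟩

variable {τ} in
theorem Represents.add {x y : τ.L2 →L[ℂ] τ.L2} {ξ η : τ.L2} (h : τ.Represents x ξ)
    (h' : τ.Represents y η) : τ.Represents (x + y) (ξ + η) :=
  ⟨add_mem h.1 h'.1, fun b => by simp [h.2, h'.2]⟩

/-! ### Lower semicontinuity of the trace and uniqueness of the vector of an operator. -/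

theorem lowerSemicontinuous_sq : LowerSemicontinuous τ.sq := by
  intro a y hy
  have h := τ.lowerSemicontinuous (star a * a) (star_mul_self_nonneg a) y hy
  have hc : Filter.Tendsto (fun x : A => star x * x) (nhds a)
      (nhdsWithin (star a * a) {a : A | 0 ≤ a}) :=
    tendsto_nhdsWithin_iff.2 ⟨(continuous_star.mul continuous_id).tendsto a,
      Filter.Eventually.of_forall fun x => star_mul_self_nonneg x⟩
  exact hc.eventually h

theorem dense_sqIntegrable : Dense (τ.sqIntegrable : Set A) := by
  have hpos : {a : A | 0 ≤ a} ⊆ closure (τ.sqIntegrable : Set A) := by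
    refine τ.denselyDefined.trans (closure_mono ?_)
    rintro a ⟨ha, hτ⟩
    -- Finite trace of `v⋆v` says that `v` is square integrable, and square integrable elements form
    -- an ideal.
    obtain ⟨v, rfl⟩ := CStarAlgebra.nonneg_iff_eq_star_mul_self.1 ha
    exact lt_of_le_of_lt (τ.sq_mul_left (star v) v)
      (ENNReal.mul_lt_top ENNReal.ofReal_lt_top hτ)
  have h : (⊤ : Submodule ℂ A) ≤ τ.sqIntegrable.topologicalClosure := by
    rw [← CStarAlgebra.span_nonneg, Submodule.span_le]
    exact hpos
  exact fun a => h (Submodule.mem_top (x := a))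

theorem sq_eq_ofReal_norm (a : τ.sqIntegrable) :
    τ.sq (a : A) = ENNReal.ofReal (‖τ.toL2 a‖ ^ 2) := by
  rw [norm_sq_toL2, ENNReal.ofReal_toReal]
  · rfl
  · exact ne_of_lt a.2

/-- Lower semicontinuity only bounds L² norms from below, so it is applied to `a + ea → 2a` along an
approximate unit. Since `‖ea‖ ≤ ‖a‖` in L², the parallelogram law then makes `a - ea` small. Finally
`e` is replaced by a norm-close square integrable `c`. -/
theorem exists_mul_left_approx (a : τ.sqIntegrable) {ε : ℝ} (hε : 0 < ε) :
    ∃ c : τ.sqIntegrable, ‖τ.toL2 a - τ.gns (c : A) (τ.toL2 a)‖ < ε := by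
  rcases eq_or_ne (τ.toL2 a) 0 with h0 | h0
  · exact ⟨0, by simpa [h0] using hε⟩
  have hpos : 0 < ‖τ.toL2 a‖ := norm_pos_iff.2 h0
  have hu := CStarAlgebra.increasingApproximateUnit A
  have := hu.neBot
  have hlim : Filter.Tendsto (fun e : A => (a : A) + e * a) (CStarAlgebra.approximateUnit A)
      (nhds ((a : A) + a)) := tendsto_const_nhds.add (hu.tendsto_mul_right _)
  have hlt : ENNReal.ofReal (4 * ‖τ.toL2 a‖ ^ 2 - (ε / 2) ^ 2) < τ.sq ((a : A) + a) := by
    have h2 : ‖τ.toL2 (a + a)‖ = 2 * ‖τ.toL2 a‖ := by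
      rw [_root_.map_add, ← two_smul ℂ, norm_smul]
      simp
    have := τ.sq_eq_ofReal_norm (a + a)
    rw [Submodule.coe_add] at this
    rw [this, ENNReal.ofReal_lt_ofReal_iff] <;> rw [h2] <;> nlinarith [sq_nonneg ε, sq_pos_of_pos hε]
  obtain ⟨e, he, hen⟩ := ((hlim.eventually (τ.lowerSemicontinuous_sq _ _ hlt)).and
    hu.eventually_norm).exists
  have hsum : τ.toL2 a + τ.gns e (τ.toL2 a) =
      τ.toL2 (a + ⟨e * a, τ.mul_left_mem e (τ.toPreL2 a)⟩) := by
    rw [gns_toL2, _root_.map_add]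
  have he' : 4 * ‖τ.toL2 a‖ ^ 2 - (ε / 2) ^ 2 < ‖τ.toL2 a + τ.gns e (τ.toL2 a)‖ ^ 2 := by
    rw [hsum]
    have hs : τ.sq ((a : A) + e * a) = ENNReal.ofReal (‖τ.toL2 (a + ⟨e * a,
        τ.mul_left_mem e (τ.toPreL2 a)⟩)‖ ^ 2) :=
      τ.sq_eq_ofReal_norm (a + ⟨e * a, τ.mul_left_mem e (τ.toPreL2 a)⟩)
    rw [hs] at he
    exact lt_of_not_ge fun hge => absurd he (not_lt.2 (ENNReal.ofReal_le_ofReal hge))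
  have hea : ‖τ.gns e (τ.toL2 a)‖ ≤ ‖τ.toL2 a‖ :=
    (τ.norm_gns_apply_le e _).trans (mul_le_of_le_one_left (norm_nonneg _) hen)
  have hpar := parallelogram_law_with_norm ℂ (τ.toL2 a) (τ.gns e (τ.toL2 a))
  have h1 : ‖τ.toL2 a - τ.gns e (τ.toL2 a)‖ < ε / 2 := by
    refine lt_of_pow_lt_pow_left₀ 2 (by positivity) ?_
    nlinarith [norm_nonneg (τ.gns e (τ.toL2 a))]
  obtain ⟨c, hc, hec⟩ := Metric.mem_closure_iff.1 (τ.dense_sqIntegrable e)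
    (ε / 2 / ‖τ.toL2 a‖) (by positivity)
  rw [dist_eq_norm, lt_div_iff₀ hpos] at hec
  refine ⟨⟨c, hc⟩, ?_⟩
  have h2 : τ.toL2 a - τ.gns c (τ.toL2 a) =
      (τ.toL2 a - τ.gns e (τ.toL2 a)) + τ.gns (e - c) (τ.toL2 a) := by
    rw [gns_sub, sub_apply]
    abel
  have h3 := τ.norm_gns_apply_le (e - c) (τ.toL2 a)
  change ‖τ.toL2 a - τ.gns c (τ.toL2 a)‖ < ε
  rw [h2]
  linarith [norm_add_le (τ.toL2 a - τ.gns e (τ.toL2 a)) (τ.gns (e - c) (τ.toL2 a))]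

/-- For square integrable `c`, `⟪ca, ξ⟫ = ⟪c, ξa⋆⟫ = 0`, and such `ca` approximate `a` in L². Square
integrability of `c` is what allows `ca` to be read as a right multiplication applied to `c`. -/
theorem eq_zero_of_rightMul_eq_zero {ξ : τ.L2}
    (h : ∀ b : τ.sqIntegrable, τ.rightMul (b : A) ξ = 0) : ξ = 0 := by
  have h0 : ∀ a : τ.sqIntegrable, ⟪τ.toL2 a, ξ⟫_ℂ = 0 := by
    intro a
    by_contra hne
    obtain ⟨c, hc⟩ := τ.exists_mul_left_approx a (ε := ‖⟪τ.toL2 a, ξ⟫_ℂ‖ / (‖ξ‖ + 1))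
      (div_pos (norm_pos_iff.2 hne) (by positivity))
    have h1 : ⟪τ.gns (c : A) (τ.toL2 a), ξ⟫_ℂ = 0 := by
      rw [gns_rightMul_toL2, inner_rightMul_left, h ⟨star (a : A), τ.star_mem (τ.toPreL2 a)⟩]
      exact inner_zero_right _
    have h2 : ‖⟪τ.toL2 a, ξ⟫_ℂ‖ ≤ ‖τ.toL2 a - τ.gns (c : A) (τ.toL2 a)‖ * ‖ξ‖ := by
      refine le_trans (le_of_eq ?_) (norm_inner_le_norm (𝕜 := ℂ) _ _)
      rw [inner_sub_left, h1, sub_zero]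
    rw [lt_div_iff₀ (by positivity)] at hc
    nlinarith [norm_nonneg (τ.toL2 a - τ.gns (c : A) (τ.toL2 a))]
  exact τ.denseRange_toL2.eq_zero_of_inner_right (𝕜 := ℂ) h0

variable {τ} in
theorem Represents.unique {x : τ.L2 →L[ℂ] τ.L2} {ξ η : τ.L2} (h : τ.Represents x ξ)
    (h' : τ.Represents x η) : ξ = η := by
  rw [← sub_eq_zero]
  refine τ.eq_zero_of_rightMul_eq_zero fun b => ?_
  rw [map_sub, ← h.2, ← h'.2, sub_self]

end CStarTrace

/-! ### Truncation by functional calculus. -/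

section Truncation

variable {A : Type*} [NonUnitalCStarAlgebra A]

/-- The truncation `b ∧ r` of a self-adjoint element at height `r`. -/
def truncAbove (r : ℝ) (b : A) : A := cfcₙ (fun t : ℝ => min t r) b

/-- The positive element `(b - r)₊`. -/
def excess (r : ℝ) (b : A) : A := cfcₙ (fun t : ℝ => max (t - r) 0) b

/-- The square root of `(b - r)₊`. -/
def sqrtExcess (r : ℝ) (b : A) : A := cfcₙ (fun t : ℝ => √(max (t - r) 0)) b

theorem isSelfAdjoint_truncAbove (r : ℝ) (b : A) : IsSelfAdjoint (truncAbove r b) :=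
  cfcₙ_predicate _ _

theorem isSelfAdjoint_sqrtExcess (r : ℝ) (b : A) : IsSelfAdjoint (sqrtExcess r b) :=
  cfcₙ_predicate _ _

variable {r : ℝ} {b : A}

theorem truncAbove_add_excess (hr : 0 ≤ r) (hb : IsSelfAdjoint b) : truncAbove r b + excess r b = b := by
  unfold truncAbove excess
  rw [← cfcₙ_add (fun t : ℝ => min t r) (fun t => max (t - r) 0) b (by fun_prop) (by simp [hr])
    (by fun_prop) (by simp [hr])]
  conv_rhs => rw [← cfcₙ_id' ℝ b]
  congr 1
  ext t
  rcases le_total t r with h | h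
  · rw [min_eq_left h, max_eq_right (by linarith), add_zero]
  · rw [min_eq_right h, max_eq_left (by linarith)]
    ring

theorem sqrtExcess_mul_self (hr : 0 ≤ r) : sqrtExcess r b * sqrtExcess r b = excess r b := by
  unfold sqrtExcess excess
  rw [← cfcₙ_mul _ _ b (by fun_prop) (by simp [hr]) (by fun_prop) (by simp [hr])]
  congr 1
  ext t
  exact Real.mul_self_sqrt (le_max_right _ _)

/-- The root is supported on `t ≥ r`, where the truncation is constantly `r`. -/
theorem truncAbove_mul_sqrtExcess (hr : 0 ≤ r) : truncAbove r b * sqrtExcess r b = r • sqrtExcess r b := by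
  unfold sqrtExcess truncAbove
  rw [← cfcₙ_mul _ _ b (by fun_prop) (by simp [hr]) (by fun_prop) (by simp [hr]),
    ← cfcₙ_smul r _ b (by fun_prop) (by simp [hr])]
  congr 1
  ext t
  rcases le_total t r with h | h
  · rw [max_eq_right (by linarith)]
    simp
  · rw [min_eq_right h, smul_eq_mul]

theorem quasispectrum_truncAbove (hr : 0 ≤ r) (hb : IsSelfAdjoint b) :
    quasispectrum ℝ (truncAbove r b) ⊆ Set.Iic r := by
  unfold truncAbove
  rw [cfcₙ_map_quasispectrum _ b (by fun_prop) (by simp [hr]) hb]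
  rintro _ ⟨t, -, rfl⟩
  exact min_le_right t r

/-- A substitute for `b ≤ r · 1` when there is no unit: `v` and `w` are the square roots of the
positive and negative parts. It serves both for operators on L² and for values of `ω`. -/
theorem exists_sub_of_quasispectrum_subset_Iic (hr : 0 ≤ r) (hb : IsSelfAdjoint b)
    (h : quasispectrum ℝ b ⊆ Set.Iic r) :
    ∃ v w : A, b = star v * v - star w * w ∧ ‖v‖ ^ 2 ≤ r := by
  -- The real square root is `0` at negative arguments, so no explicit positive part is needed.
  refine ⟨cfcₙ (fun t : ℝ => √t) b, cfcₙ (fun t : ℝ => √(-t)) b, ?_, ?_⟩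
  · rw [IsSelfAdjoint.star_eq (cfcₙ_predicate (R := ℝ) _ b),
      IsSelfAdjoint.star_eq (cfcₙ_predicate (R := ℝ) _ b),
      ← cfcₙ_mul _ _ b (by fun_prop) (by simp) (by fun_prop) (by simp),
      ← cfcₙ_mul _ _ b (by fun_prop) (by simp) (by fun_prop) (by simp),
      ← cfcₙ_sub _ _ b (by fun_prop) (by simp) (by fun_prop) (by simp)]
    conv_lhs => rw [← cfcₙ_id' ℝ b]
    congr 1
    ext t
    rcases le_total t 0 with ht | ht
    · rw [Real.sqrt_eq_zero_of_nonpos ht, Real.mul_self_sqrt (by linarith)]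
      ring
    · rw [Real.mul_self_sqrt ht, Real.sqrt_eq_zero_of_nonpos (x := -t) (by linarith)]
      ring
  · have : ‖cfcₙ (fun t : ℝ => √t) b‖ ≤ √r := norm_cfcₙ_le fun t ht => by
      rw [Real.norm_eq_abs, abs_of_nonneg (Real.sqrt_nonneg _)]
      exact Real.sqrt_le_sqrt (h ht)
    calc _ ≤ √r ^ 2 := by gcongr
      _ = r := Real.sq_sqrt hr

end Truncation

theorem truncAbove_smul {A : Type*} [NonUnitalCStarAlgebra A] {r : ℝ} (hr : 0 < r) {b : A}
    (hb : IsSelfAdjoint b) : truncAbove 1 (r⁻¹ • b) = r⁻¹ • truncAbove r b := by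
  unfold truncAbove
  rw [← cfcₙ_comp_smul r⁻¹ (fun t : ℝ => min t 1) b (by fun_prop) (by simp) hb,
    ← cfcₙ_smul r⁻¹ _ b (by fun_prop) (by simp [hr.le])]
  congr 1
  ext t
  simp only [smul_eq_mul]
  rw [mul_min_of_nonneg _ _ (inv_nonneg.2 hr.le), inv_mul_cancel₀ hr.ne']

/-! ### Truncations in L² and the Hilbert projection. -/

namespace CStarTrace

variable {A : Type*} [NonUnitalCStarAlgebra A] [PartialOrder A] [StarOrderedRing A]
  (τ : CStarTrace A)

theorem sq_cfcₙ_le (f : ℝ → ℝ) (hf : Continuous f) (hf0 : f 0 = 0) {c : ℝ} (hc : 0 ≤ c)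
    (h : ∀ t, f t ^ 2 ≤ c * t ^ 2) {b : A} (hb : IsSelfAdjoint b) :
    τ.sq (cfcₙ f b) ≤ ENNReal.ofReal c * τ.sq b := by
  unfold sq
  rw [← τ.map_smul _ _ hc (star_mul_self_nonneg b)]
  refine τ.mono (star_mul_self_nonneg _) ?_
  rw [IsSelfAdjoint.star_eq (cfcₙ_predicate (R := ℝ) f b), hb.star_eq,
    ← cfcₙ_mul _ _ b (by fun_prop) (by simp [hf0]) (by fun_prop) (by simp [hf0])]
  conv_rhs => rw [← cfcₙ_id' ℝ b,
    ← cfcₙ_mul _ _ b (by fun_prop) (by simp) (by fun_prop) (by simp),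
    ← cfcₙ_smul c _ b (by fun_prop) (by simp)]
  refine cfcₙ_mono (fun t _ => ?_) (by fun_prop) (by fun_prop) (by simp [hf0]) (by simp)
  have := h t
  simp only [smul_eq_mul]
  nlinarith

theorem sq_truncAbove_le {r : ℝ} (hr : 0 ≤ r) {b : A} (hb : IsSelfAdjoint b) :
    τ.sq (truncAbove r b) ≤ τ.sq b := by
  refine (τ.sq_cfcₙ_le (fun t => min t r) (by fun_prop) (by simp [hr]) zero_le_one
    (fun t => ?_) hb).trans_eq (by simp)
  rcases le_total t r with h | h
  · rw [min_eq_left h, one_mul]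
  · rw [min_eq_right h]
    nlinarith

theorem truncAbove_mem {r : ℝ} (hr : 0 ≤ r) (b : τ.sqIntegrable) (hb : IsSelfAdjoint (b : A)) :
    truncAbove r (b : A) ∈ τ.sqIntegrable :=
  (τ.sq_truncAbove_le hr hb).trans_lt b.2

theorem norm_toL2_truncAbove_le {r : ℝ} (hr : 0 ≤ r) (b : τ.sqIntegrable)
    (hb : IsSelfAdjoint (b : A)) :
    ‖τ.toL2 ⟨truncAbove r (b : A), τ.truncAbove_mem hr b hb⟩‖ ≤ ‖τ.toL2 b‖ := by
  have h := τ.sq_truncAbove_le hr hb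
  have h1 := τ.sq_eq_ofReal_norm ⟨truncAbove r (b : A), τ.truncAbove_mem hr b hb⟩
  rw [h1, τ.sq_eq_ofReal_norm, ENNReal.ofReal_le_ofReal_iff (by positivity)] at h
  exact (sq_le_sq₀ (norm_nonneg _) (norm_nonneg _)).1 h

theorem excess_mem {r : ℝ} (hr : 0 ≤ r) (b : τ.sqIntegrable) (hb : IsSelfAdjoint (b : A)) :
    excess r (b : A) ∈ τ.sqIntegrable := by
  rw [eq_sub_of_add_eq' (truncAbove_add_excess hr hb)]
  exact sub_mem b.2 (τ.truncAbove_mem hr b hb)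

theorem sqrtExcess_mem {r : ℝ} (hr : 0 < r) (b : τ.sqIntegrable) (hb : IsSelfAdjoint (b : A)) :
    sqrtExcess r (b : A) ∈ τ.sqIntegrable := by
  -- The constant `r⁻¹` comes from `(t - r)₊ ≤ t² / r`.
  refine (τ.sq_cfcₙ_le (fun t => √(max (t - r) 0)) (by fun_prop) (by simp [hr.le])
    (inv_nonneg.2 hr.le) (fun t => ?_) hb).trans_lt
      (ENNReal.mul_lt_top ENNReal.ofReal_lt_top b.2)
  rw [Real.sq_sqrt (le_max_right _ _), ← div_eq_inv_mul, le_div_iff₀ hr]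
  rcases le_total t r with h | h
  · rw [max_eq_right (by linarith), zero_mul]
    positivity
  · rw [max_eq_left (by linarith)]
    nlinarith

/-- Write `u = b ∧ r` and `p = (b - r)₊ = s * s`. Moving one factor `s` across gives `Re⟪p, ξ⟫ =
Re⟪s, Ts⟫ ≤ r‖s‖² = Re⟪p, u⟫`, so `‖p‖² = Re⟪p, b - u⟫ ≤ Re⟪p, b - ξ⟫`. Using `ξ` only through its
multiplication operator `T` covers both elements of A and elements of M. -/
theorem norm_excess_le {r : ℝ} (hr : 0 < r) (b : τ.sqIntegrable) (hb : IsSelfAdjoint (b : A))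
    {T : τ.L2 →L[ℂ] τ.L2} {ξ : τ.L2}
    (hT : ∀ s : τ.sqIntegrable, T (τ.toL2 s) = τ.rightMul (s : A) ξ)
    (hle : ∀ s : τ.sqIntegrable, (⟪τ.toL2 s, T (τ.toL2 s)⟫_ℂ).re ≤ r * ‖τ.toL2 s‖ ^ 2) :
    ‖τ.toL2 b - τ.toL2 ⟨truncAbove r (b : A), τ.truncAbove_mem hr.le b hb⟩‖ ≤
      ‖τ.toL2 b - ξ‖ := by
  set p : τ.sqIntegrable := ⟨excess r (b : A), τ.excess_mem hr.le b hb⟩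
  set u : τ.sqIntegrable := ⟨truncAbove r (b : A), τ.truncAbove_mem hr.le b hb⟩
  set s : τ.sqIntegrable := ⟨sqrtExcess r (b : A), τ.sqrtExcess_mem hr b hb⟩
  have hup : u + p = b := Subtype.ext (truncAbove_add_excess hr.le hb)
  have hs : star (s : A) = s := (isSelfAdjoint_sqrtExcess r (b : A)).star_eq
  have hp : τ.toL2 p = τ.rightMul (s : A) (τ.toL2 s) := by
    rw [rightMul_toL2]
    exact congrArg _ (Subtype.ext (sqrtExcess_mul_self hr.le).symm)
  have hp' : ∀ η, ⟪τ.toL2 p, η⟫_ℂ = ⟪τ.toL2 s, τ.rightMul (s : A) η⟫_ℂ := fun η => by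
    rw [hp, inner_rightMul_left, hs]
  have hus : τ.rightMul (s : A) (τ.toL2 u) = (r : ℂ) • τ.toL2 s := by
    rw [rightMul_toL2, ← _root_.map_smul]
    refine congrArg _ (Subtype.ext ?_)
    exact (truncAbove_mul_sqrtExcess hr.le).trans (Complex.coe_smul r _).symm
  have h1 : (⟪τ.toL2 p, ξ⟫_ℂ).re ≤ (⟪τ.toL2 p, τ.toL2 u⟫_ℂ).re := by
    rw [hp', hp', ← hT, hus, inner_smul_right, inner_self_eq_norm_sq_to_K]
    refine (hle s).trans_eq ?_
    rw [Complex.re_ofReal_mul]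
    norm_cast
  have hbu : τ.toL2 b - τ.toL2 u = τ.toL2 p := by
    rw [← hup, _root_.map_add]
    abel
  have h2 : ‖τ.toL2 p‖ ^ 2 ≤ ‖τ.toL2 p‖ * ‖τ.toL2 b - ξ‖ := by
    have h3 : ‖τ.toL2 p‖ ^ 2 = (⟪τ.toL2 p, τ.toL2 b - τ.toL2 u⟫_ℂ).re := by
      rw [hbu, inner_self_eq_norm_sq_to_K]
      norm_cast
    have h4 : (⟪τ.toL2 p, τ.toL2 b - ξ⟫_ℂ).re ≤ ‖τ.toL2 p‖ * ‖τ.toL2 b - ξ‖ :=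
      (Complex.re_le_norm _).trans (norm_inner_le_norm _ _)
    rw [inner_sub_right, Complex.sub_re] at h3 h4
    linarith
  rw [hbu]
  nlinarith [norm_nonneg (τ.toL2 p), norm_nonneg (τ.toL2 b - ξ)]

theorem inner_gns_star_mul (v : A) (ξ η : τ.L2) :
    ⟪ξ, τ.gns (star v * v) η⟫_ℂ = ⟪τ.gns v ξ, τ.gns v η⟫_ℂ := by
  rw [inner_gns_left]
  congr 1
  refine τ.denseRange_toL2.induction_on η (isClosed_eq (τ.gns _).continuous
    ((τ.gns _).continuous.comp (τ.gns _).continuous)) fun a => ?_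
  rw [gns_toL2, gns_toL2, gns_toL2]
  exact congrArg _ (Subtype.ext (mul_assoc _ _ _))

theorem re_inner_gns_le {r : ℝ} (hr : 0 ≤ r) {b : A} (hb : IsSelfAdjoint b)
    (h : quasispectrum ℝ b ⊆ Set.Iic r) (ξ : τ.L2) :
    (⟪ξ, τ.gns b ξ⟫_ℂ).re ≤ r * ‖ξ‖ ^ 2 := by
  obtain ⟨v, w, rfl, hv⟩ := exists_sub_of_quasispectrum_subset_Iic hr hb h
  have h1 : ∀ η : τ.L2, (⟪η, η⟫_ℂ).re = ‖η‖ ^ 2 := fun η => inner_self_eq_norm_sq (𝕜 := ℂ) η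
  rw [gns_sub, sub_apply, inner_sub_right, inner_gns_star_mul, inner_gns_star_mul, Complex.sub_re,
    h1, h1]
  have h2 : ‖τ.gns v ξ‖ ^ 2 ≤ (‖v‖ * ‖ξ‖) ^ 2 := by
    gcongr
    exact τ.norm_gns_apply_le v ξ
  rw [mul_pow] at h2
  nlinarith [sq_nonneg ‖τ.gns w ξ‖, sq_nonneg ‖ξ‖]

/-- Makes the Markov property usable: the abstract projection is computed inside A. The inequality
is closed in `c`, so it is enough to compare with elements of A below `1`. -/
theorem isHilbertProjection_truncAbove (b : τ.sqIntegrable) (hb : IsSelfAdjoint (b : A)) :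
    IsHilbertProjection τ.leOne (τ.toL2 b)
      (τ.toL2 ⟨truncAbove 1 (b : A), τ.truncAbove_mem zero_le_one b hb⟩) := by
  refine ⟨subset_closure ⟨_, ⟨isSelfAdjoint_truncAbove _ _,
    quasispectrum_truncAbove zero_le_one hb⟩, rfl⟩, fun c hc => ?_⟩
  refine closure_minimal (t := {c | ‖τ.toL2 b - τ.toL2 ⟨truncAbove 1 (b : A),
    τ.truncAbove_mem zero_le_one b hb⟩‖ ≤ ‖τ.toL2 b - c‖}) ?_
      (isClosed_le continuous_const (by fun_prop)) hc
  rintro _ ⟨a, ⟨ha, ha'⟩, rfl⟩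
  exact τ.norm_excess_le zero_lt_one b hb (τ.represents_gns a).2
    fun s => τ.re_inner_gns_le zero_le_one ha ha' _

end CStarTrace

/-! ### The domain as a Hilbert space, and weak convergence in it. -/

namespace ClosedForm

variable {H : Type*} [NormedAddCommGroup H] [InnerProductSpace ℂ H] (E : ClosedForm H)

theorem innerF_self_re (ξ : E.domain) :
    (E.innerF ξ ξ).re = E.energy ξ + ‖(ξ : H)‖ ^ 2 := by
  unfold innerF energy
  rw [Complex.add_re, ← inner_self_eq_norm_sq (𝕜 := ℂ) (ξ : H)]
  rfl

/-- The domain of the form, regarded as a Hilbert space for the scalar product `innerF`. -/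
def DirichletSpace : Type _ := E.domain

instance : AddCommGroup E.DirichletSpace := inferInstanceAs (AddCommGroup E.domain)
instance : Module ℂ E.DirichletSpace := inferInstanceAs (Module ℂ E.domain)

def toDirichletSpace : E.domain ≃ₗ[ℂ] E.DirichletSpace := LinearEquiv.refl ℂ _

/-- The pre-Hilbert space structure of the Dirichlet space. -/
@[reducible]
def dirichletCore : InnerProductSpace.Core ℂ E.DirichletSpace where
  inner ξ η := E.innerF (E.toDirichletSpace.symm ξ) (E.toDirichletSpace.symm η)
  conj_inner_symm ξ η := by
    unfold innerF
    rw [_root_.map_add, ← E.hermitian, inner_conj_symm]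
  re_inner_nonneg ξ := by
    have h := E.innerF_self_re (E.toDirichletSpace.symm ξ)
    have h1 : 0 ≤ E.energy (E.toDirichletSpace.symm ξ) := E.nonneg _
    change 0 ≤ (E.innerF _ _).re
    rw [h]
    positivity
  add_left ξ η ζ := by
    unfold innerF
    simp only [_root_.map_add, LinearMap.add_apply, Submodule.coe_add, inner_add_left]
    ring
  smul_left ξ η z := by
    unfold innerF
    simp only [_root_.map_smul, LinearMap.map_smulₛₗ, LinearMap.smul_apply, Submodule.coe_smul,
      inner_smul_left, smul_eq_mul]
    ring
  definite ξ h := by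
    have h0 := E.innerF_self_re (E.toDirichletSpace.symm ξ)
    rw [h] at h0
    have h1 : 0 ≤ E.energy (E.toDirichletSpace.symm ξ) := E.nonneg _
    have h2 : ‖((E.toDirichletSpace.symm ξ : E.domain) : H)‖ ^ 2 = 0 := by
      simp only [Complex.zero_re] at h0
      nlinarith [sq_nonneg ‖((E.toDirichletSpace.symm ξ : E.domain) : H)‖]
    exact E.toDirichletSpace.symm.map_eq_zero_iff.1
      (Subtype.ext (norm_eq_zero.1 (pow_eq_zero_iff two_ne_zero |>.1 h2)))

instance : NormedAddCommGroup E.DirichletSpace := E.dirichletCore.toNormedAddCommGroup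
instance : InnerProductSpace ℂ E.DirichletSpace := InnerProductSpace.ofCore E.dirichletCore.toCore

theorem inner_toDirichletSpace (ξ η : E.domain) :
    ⟪E.toDirichletSpace ξ, E.toDirichletSpace η⟫_ℂ = E.innerF ξ η := rfl

theorem norm_sq_toDirichletSpace (ξ : E.domain) :
    ‖E.toDirichletSpace ξ‖ ^ 2 = E.energy ξ + ‖(ξ : H)‖ ^ 2 := by
  rw [← inner_self_eq_norm_sq (𝕜 := ℂ), inner_toDirichletSpace]
  exact E.innerF_self_re ξ

theorem norm_toDirichletSpace (ξ : E.domain) : ‖E.toDirichletSpace ξ‖ = E.normF ξ := by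
  unfold normF
  rw [← norm_sq_toDirichletSpace, Real.sqrt_sq (norm_nonneg _)]

/-- Closedness of the form is exactly completeness for the graph norm. -/
instance : CompleteSpace E.DirichletSpace := by
  refine Metric.complete_of_cauchySeq_tendsto fun u hu => ?_
  obtain ⟨ξ, hξ⟩ := E.closed (fun n => E.toDirichletSpace.symm (u n)) fun ε hε => by
    obtain ⟨N, hN⟩ := Metric.cauchySeq_iff.1 hu (√ε) (Real.sqrt_pos.2 hε)
    refine ⟨N, fun m hm n hn => ?_⟩
    have h := hN m hm n hn
    rw [dist_eq_norm, Real.lt_sqrt (norm_nonneg _)] at h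
    exact (E.norm_sq_toDirichletSpace (E.toDirichletSpace.symm (u m - u n))).symm.trans_lt h
  refine ⟨E.toDirichletSpace ξ, Metric.tendsto_atTop.2 fun ε hε => ?_⟩
  obtain ⟨N, hN⟩ := hξ (ε ^ 2) (by positivity)
  refine ⟨N, fun n hn => ?_⟩
  have h := hN n hn
  rw [dist_eq_norm]
  refine lt_of_pow_lt_pow_left₀ 2 hε.le ?_
  exact (E.norm_sq_toDirichletSpace (E.toDirichletSpace.symm (u n) - ξ)).trans_lt h

theorem norm_le_normF (ξ : E.domain) : ‖(ξ : H)‖ ≤ E.normF ξ := by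
  have h1 : 0 ≤ E.energy ξ := E.nonneg _
  exact Real.le_sqrt_of_sq_le (by linarith)

theorem normF_add_le (ξ η : E.domain) : E.normF (ξ + η) ≤ E.normF ξ + E.normF η := by
  rw [← norm_toDirichletSpace, ← norm_toDirichletSpace, ← norm_toDirichletSpace, _root_.map_add]
  exact norm_add_le _ _

theorem normF_sub_le (ξ η : E.domain) : E.normF (ξ - η) ≤ E.normF ξ + E.normF η := by
  rw [← norm_toDirichletSpace, ← norm_toDirichletSpace, ← norm_toDirichletSpace, map_sub]
  exact norm_sub_le _ _

theorem normF_smul (z : ℂ) (ξ : E.domain) : E.normF (z • ξ) = ‖z‖ * E.normF ξ := by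
  rw [← norm_toDirichletSpace, ← norm_toDirichletSpace, _root_.map_smul, norm_smul]

theorem normF_nonneg (ξ : E.domain) : 0 ≤ E.normF ξ := Real.sqrt_nonneg _

theorem innerF_add_right (ξ η ζ : E.domain) :
    E.innerF ξ (η + ζ) = E.innerF ξ η + E.innerF ξ ζ :=
  inner_add_right (E.toDirichletSpace ξ) (E.toDirichletSpace η) (E.toDirichletSpace ζ)

theorem innerF_smul_right (ξ η : E.domain) (z : ℂ) :
    E.innerF ξ (z • η) = z * E.innerF ξ η :=
  inner_smul_right (E.toDirichletSpace ξ) (E.toDirichletSpace η) z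

/-- The inclusion of the Dirichlet space in the ambient Hilbert space. -/
def inclusion : E.DirichletSpace →L[ℂ] H :=
  LinearMap.mkContinuous (E.domain.subtype ∘ₗ E.toDirichletSpace.symm.toLinearMap) 1 fun ξ => by
    rw [one_mul]
    exact (E.norm_le_normF (E.toDirichletSpace.symm ξ)).trans_eq (E.norm_toDirichletSpace _).symm

/-- A bounded sequence of the Dirichlet space which converges in the ambient Hilbert space to an
element of the domain converges weakly in the Dirichlet space. -/
theorem tendsto_innerF [CompleteSpace H] {u : ℕ → E.domain} {ξ : E.domain} {C : ℝ}
    (hu : ∀ n, E.normF (u n) ≤ C)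
    (hlim : Filter.Tendsto (fun n => (u n : H)) Filter.atTop (nhds (ξ : H))) (G : E.domain) :
    Filter.Tendsto (fun n => E.innerF G (u n)) Filter.atTop (nhds (E.innerF G ξ)) := by
  -- The inclusion `ι` of F in `H` is injective, so `ι⋆` has dense range. Against `ι⋆h` the
  -- F-pairing is the pairing of `H` with `h`, where convergence is given; the remaining error is
  -- controlled by the bound `K` on `‖uₙ - ξ‖_F`.
  have hdense : DenseRange (ContinuousLinearMap.adjoint E.inclusion) := by
    have hker : LinearMap.ker E.inclusion.toLinearMap = ⊥ := LinearMap.ker_eq_bot'.2 fun η hη =>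
      E.toDirichletSpace.symm.map_eq_zero_iff.1 (Subtype.ext hη)
    have := ContinuousLinearMap.orthogonal_ker E.inclusion
    rw [hker, Submodule.bot_orthogonal_eq_top] at this
    intro x
    have hx : x ∈ (ContinuousLinearMap.adjoint E.inclusion).range.topologicalClosure := by
      rw [← this]
      trivial
    exact hx
  have hC : 0 ≤ C := (E.normF_nonneg _).trans (hu 0)
  set K := C + E.normF ξ + 1 with hK
  have hKpos : 0 < K := by linarith [E.normF_nonneg ξ]
  refine Metric.tendsto_atTop.2 fun ε hε => ?_
  obtain ⟨h, hh⟩ := hdense.exists_dist_lt (E.toDirichletSpace G) (ε := ε / 2 / K) (by positivity)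
  obtain ⟨N, hN⟩ := Metric.tendsto_atTop.1 hlim (ε / 2 / (‖h‖ + 1)) (by positivity)
  refine ⟨N, fun n hn => ?_⟩
  have h1 := hN n hn
  rw [dist_eq_norm, lt_div_iff₀ (by positivity)] at h1 hh
  set w : E.DirichletSpace := E.toDirichletSpace (u n - ξ) with hw
  have h2 : E.innerF G (u n) - E.innerF G ξ =
      ⟪E.toDirichletSpace G - ContinuousLinearMap.adjoint E.inclusion h, w⟫_ℂ +
        ⟪h, (u n : H) - ξ⟫_ℂ := by
    rw [inner_sub_left, ContinuousLinearMap.adjoint_inner_left]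
    have h3 : E.inclusion w = (u n : H) - ξ := rfl
    rw [h3, hw, map_sub, inner_sub_right, inner_toDirichletSpace, inner_toDirichletSpace]
    ring
  have h4 : ‖w‖ ≤ K := by
    rw [hw, norm_toDirichletSpace]
    linarith [E.normF_sub_le (u n) ξ, hu n]
  rw [dist_eq_norm, h2]
  refine (norm_add_le _ _).trans_lt ?_
  have h5 := norm_inner_le_norm (𝕜 := ℂ)
    (E.toDirichletSpace G - ContinuousLinearMap.adjoint E.inclusion h) w
  have h6 := norm_inner_le_norm (𝕜 := ℂ) h ((u n : H) - ξ)
  have h7 := mul_le_mul_of_nonneg_left h4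
    (norm_nonneg (E.toDirichletSpace G - ContinuousLinearMap.adjoint E.inclusion h))
  nlinarith [norm_nonneg h, norm_nonneg ((u n : H) - ξ)]

end ClosedForm

/-! ### Norm bounds from real parts, and positive functionals. -/

/-- A linear functional is bounded at `x` by a bound for the real parts of its values at the
real parts of the rotations of `x`. -/
theorem norm_le_of_forall_rotation {V : Type*} [AddCommGroup V] [Module ℂ V] (f : V →ₗ[ℂ] ℂ)
    (x : V) {C : ℝ} (h : ∀ z : ℂ, ‖z‖ = 1 → ∃ y₁ y₂ : V, z • x = y₁ + Complex.I • y₂ ∧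
      (f y₁).im = 0 ∧ (f y₂).im = 0 ∧ (f y₁).re ≤ C) : ‖f x‖ ≤ C := by
  -- With this phase `f (z • x)` is real, hence equal to `Re f(y₁)`, as `I * f y₂` is purely
  -- imaginary.
  obtain ⟨z, hz, hzx⟩ : ∃ z : ℂ, ‖z‖ = 1 ∧ z * f x = ‖f x‖ := by
    rcases eq_or_ne (f x) 0 with h0 | h0
    · exact ⟨1, by simp, by simp [h0]⟩
    · have hn : (‖f x‖ : ℂ) ≠ 0 := by exact_mod_cast norm_ne_zero_iff.2 h0
      refine ⟨starRingEnd ℂ (f x) / ‖f x‖, ?_, ?_⟩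
      · rw [norm_div, RCLike.norm_conj, Complex.norm_real, norm_norm,
          div_self (norm_ne_zero_iff.2 h0)]
      · rw [div_mul_eq_mul_div, Complex.conj_mul', pow_two, mul_div_assoc, div_self hn, mul_one]
  obtain ⟨y₁, y₂, hy, h1, h2, h3⟩ := h z hz
  have h4 := congrArg f hy
  rw [_root_.map_smul, smul_eq_mul, hzx, _root_.map_add, _root_.map_smul, smul_eq_mul] at h4
  have h5 := congrArg Complex.re h4
  simp only [Complex.ofReal_re, Complex.add_re, Complex.mul_re, Complex.I_re, Complex.I_im, h2,
    zero_mul, mul_zero, sub_zero, add_zero] at h5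
  rwa [h5]

section Positive

variable {A : Type*} [NonUnitalCStarAlgebra A] [PartialOrder A] [StarOrderedRing A]
  {ω : StrongDual ℂ A}

theorem im_apply_eq_zero (hω : ∀ a : A, 0 ≤ a → 0 ≤ ω a) {a : A} (ha : IsSelfAdjoint a) :
    (ω a).im = 0 := by
  rw [← CFC.posPart_sub_negPart a ha, map_sub, Complex.sub_im,
    ← (Complex.nonneg_iff.1 (hω _ (CFC.posPart_nonneg a))).2,
    ← (Complex.nonneg_iff.1 (hω _ (CFC.negPart_nonneg a))).2, sub_zero]

theorem re_apply_le (hω : ∀ a : A, 0 ≤ a → 0 ≤ ω a) {r : ℝ} (hr : 0 ≤ r) {a : A}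
    (ha : IsSelfAdjoint a) (h : quasispectrum ℝ a ⊆ Set.Iic r) : (ω a).re ≤ r * ‖ω‖ := by
  obtain ⟨v, w, rfl, hv⟩ := exists_sub_of_quasispectrum_subset_Iic hr ha h
  have h1 := (Complex.nonneg_iff.1 (hω _ (star_mul_self_nonneg w))).1
  have h2 := (Complex.re_le_norm _).trans (ω.le_opNorm (star v * v))
  rw [CStarRing.norm_star_mul_self, ← pow_two] at h2
  rw [map_sub, Complex.sub_re]
  nlinarith [norm_nonneg ω]

end Positive

/-! ### Truncation in the domain; existence and uniqueness of the potential. -/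

namespace CStarDirichletForm

variable {A : Type*} [NonUnitalCStarAlgebra A] [PartialOrder A] [StarOrderedRing A]
  {τ : CStarTrace A} (D : CStarDirichletForm τ)

theorem conj_mem {ξ : τ.L2} (hξ : ξ ∈ D.domain) : τ.conj ξ ∈ D.domain := (D.real ⟨ξ, hξ⟩).1

theorem normF_conj (ξ : D.domain) : D.normF ⟨τ.conj ξ, D.conj_mem ξ.2⟩ = D.normF ξ := by
  obtain ⟨h, h'⟩ := D.real ξ
  unfold ClosedForm.normF
  rw [h', τ.norm_conj]

/-- The real part `(ξ + Jξ) / 2` of an element of the domain. -/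
def realPart (ξ : D.domain) : D.domain :=
  (1 / 2 : ℂ) • (ξ + ⟨τ.conj ξ, D.conj_mem ξ.2⟩)

theorem normF_realPart_le (ξ : D.domain) : D.normF (D.realPart ξ) ≤ D.normF ξ := by
  rw [realPart, D.normF_smul]
  have h := D.normF_add_le ξ ⟨τ.conj ξ, D.conj_mem ξ.2⟩
  rw [normF_conj] at h
  norm_num
  linarith

theorem realPart_sub (ξ η : D.domain) : D.realPart (ξ - η) = D.realPart ξ - D.realPart η := by
  refine Subtype.ext ?_
  simp only [realPart, Submodule.coe_smul, Submodule.coe_add, Submodule.coe_sub, map_sub,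
    ← smul_sub]
  congr 1
  abel

theorem realPart_of_conj {ξ : D.domain} (h : τ.conj ξ = ξ) : D.realPart ξ = ξ := by
  refine Subtype.ext ?_
  simp only [realPart, Submodule.coe_smul, Submodule.coe_add, h]
  rw [← two_smul ℂ, smul_smul]
  norm_num

theorem energy_smul (z : ℂ) (ξ : D.domain) : D.energy (z • ξ) = ‖z‖ ^ 2 * D.energy ξ := by
  have h1 := D.norm_sq_toDirichletSpace (z • ξ)
  have h2 := D.norm_sq_toDirichletSpace ξ
  rw [_root_.map_smul, norm_smul, mul_pow, Submodule.coe_smul, norm_smul, mul_pow] at h1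
  rw [h2] at h1
  linarith

/-- The Markov property concerns height `1`; it is applied to `b / r`, and quadratic homogeneity of
the energy cancels the factors. -/
theorem exists_normF_truncAbove_le {r : ℝ} (hr : 0 < r) (b : τ.sqIntegrable)
    (hb : IsSelfAdjoint (b : A)) (hbD : τ.toL2 b ∈ D.domain) :
    ∃ h : τ.toL2 ⟨truncAbove r (b : A), τ.truncAbove_mem hr.le b hb⟩ ∈ D.domain,
      D.normF ⟨_, h⟩ ≤ D.normF ⟨τ.toL2 b, hbD⟩ := by
  set u : τ.sqIntegrable := ⟨truncAbove r (b : A), τ.truncAbove_mem hr.le b hb⟩ with hu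
  set b' : τ.sqIntegrable := ((r⁻¹ : ℝ) : ℂ) • b with hb'
  have hcoe : (b' : A) = r⁻¹ • (b : A) := Complex.coe_smul r⁻¹ (b : A)
  have hsa : IsSelfAdjoint (b' : A) := by
    rw [hcoe]
    exact (IsSelfAdjoint.all r⁻¹).smul hb
  have hbL : τ.toL2 b' = ((r⁻¹ : ℝ) : ℂ) • τ.toL2 b := _root_.map_smul _ _ _
  have hbD' : τ.toL2 b' ∈ D.domain := by
    rw [hbL]
    exact D.domain.smul_mem _ hbD
  have hreal : τ.conj (τ.toL2 b') = τ.toL2 b' := by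
    rw [τ.conj_toL2]
    exact congrArg _ (Subtype.ext hsa.star_eq)
  obtain ⟨h, hE⟩ := D.markovian ⟨τ.toL2 b', hbD'⟩ hreal _ (τ.isHilbertProjection_truncAbove b' hsa)
  have hu' : τ.toL2 u = (r : ℂ) • τ.toL2 ⟨truncAbove 1 (b' : A),
      τ.truncAbove_mem zero_le_one b' hsa⟩ := by
    rw [← _root_.map_smul]
    refine congrArg _ (Subtype.ext ?_)
    change truncAbove r (b : A) = (r : ℂ) • truncAbove 1 (b' : A)
    rw [hcoe, truncAbove_smul hr hb, Complex.coe_smul, smul_inv_smul₀ hr.ne']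
  have huD : τ.toL2 u ∈ D.domain := by
    rw [hu']
    exact D.domain.smul_mem _ h
  refine ⟨huD, Real.sqrt_le_sqrt (add_le_add ?_ ?_)⟩
  · have h1 : (⟨τ.toL2 u, huD⟩ : D.domain) = (r : ℂ) • ⟨_, h⟩ := Subtype.ext hu'
    have h2 : (⟨τ.toL2 b', hbD'⟩ : D.domain) = ((r⁻¹ : ℝ) : ℂ) • ⟨τ.toL2 b, hbD⟩ :=
      Subtype.ext hbL
    rw [h2, energy_smul, Complex.norm_real, Real.norm_eq_abs, sq_abs, inv_pow,
      ← div_eq_inv_mul, le_div_iff₀ (by positivity)] at hE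
    rw [h1, energy_smul, Complex.norm_real, Real.norm_eq_abs, sq_abs]
    linarith
  · have := τ.norm_toL2_truncAbove_le hr.le b hb
    dsimp only
    gcongr

/-- The submodule of the square integrable elements of `A` which belong to the domain. -/
abbrev domainAlgebra : Submodule ℂ τ.sqIntegrable := D.domain.comap τ.toL2

/-- The inclusion of the Dirichlet algebra in the domain of the form. -/
def ofAlgebra : D.domainAlgebra →ₗ[ℂ] D.domain :=
  (τ.toL2.comp D.domainAlgebra.subtype).codRestrict D.domain fun b => b.2

theorem ofAlgebra_injective : Function.Injective D.ofAlgebra := fun _ _ h =>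
  Subtype.ext (τ.toL2_injective (congrArg Subtype.val h))

/-- The adjoint of an element of the Dirichlet algebra. -/
def starAlgebra (b : D.domainAlgebra) : D.domainAlgebra :=
  ⟨⟨star ((b : τ.sqIntegrable) : A), τ.star_mem (τ.toPreL2 b)⟩, by
    rw [Submodule.mem_comap, ← τ.conj_toL2]
    exact D.conj_mem b.2⟩

theorem ofAlgebra_starAlgebra (b : D.domainAlgebra) :
    (D.ofAlgebra (D.starAlgebra b) : τ.L2) = τ.conj (D.ofAlgebra b) :=
  (τ.conj_toL2 b).symm

/-- The real part of an element of the Dirichlet algebra. -/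
def realPartAlgebra (b : D.domainAlgebra) : D.domainAlgebra :=
  (1 / 2 : ℂ) • (b + D.starAlgebra b)

theorem ofAlgebra_realPartAlgebra (b : D.domainAlgebra) :
    D.ofAlgebra (D.realPartAlgebra b) = D.realPart (D.ofAlgebra b) := by
  unfold realPartAlgebra realPart
  rw [_root_.map_smul, _root_.map_add]
  congr 2
  exact Subtype.ext (D.ofAlgebra_starAlgebra b)

theorem isSelfAdjoint_realPartAlgebra (b : D.domainAlgebra) :
    IsSelfAdjoint ((D.realPartAlgebra b : τ.sqIntegrable) : A) := by
  change star ((1 / 2 : ℂ) • (((b : τ.sqIntegrable) : A) + star ((b : τ.sqIntegrable) : A))) =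
    (1 / 2 : ℂ) • (((b : τ.sqIntegrable) : A) + star ((b : τ.sqIntegrable) : A))
  rw [star_smul, star_add, star_star, add_comm]
  simp

/-- The imaginary part is the real part of `-ib`, so a single operation suffices. -/
theorem eq_realPartAlgebra_add (b : D.domainAlgebra) :
    b = D.realPartAlgebra b + Complex.I • D.realPartAlgebra (-Complex.I • b) := by
  have h : D.starAlgebra (-Complex.I • b) = Complex.I • D.starAlgebra b := by
    refine Subtype.ext (Subtype.ext ?_)
    change star (-Complex.I • ((b : τ.sqIntegrable) : A)) = Complex.I • star _
    rw [star_smul]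
    simp
  unfold realPartAlgebra
  rw [h, smul_comm Complex.I (1 / 2 : ℂ), ← smul_add, smul_add Complex.I, smul_smul, smul_smul]
  simp only [mul_neg, Complex.I_mul_I, neg_neg, one_smul, neg_smul]
  rw [show b + D.starAlgebra b + (b + -D.starAlgebra b) = (2 : ℂ) • b by
    rw [two_smul]; abel, smul_smul]
  norm_num

variable {D} {ω : StrongDual ℂ A}

/-- The hypothesis controls `ω` only on positive elements. For self-adjoint `b` it is applied to `(b
- r)₊ = b - b ∧ r`, whose graph norm is at most `2‖b‖_F`; the rest contributes at most `r‖ω‖`.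
Rotations pass to general `b`. -/
theorem IsFiniteEnergy.exists_bound (hω : D.IsFiniteEnergy ω) :
    ∃ C : ℝ, ∀ b : D.domainAlgebra, ‖ω b‖ ≤ C * D.normF (D.ofAlgebra b) := by
  obtain ⟨hpos, c, hc, hle⟩ := hω
  have key : ∀ b : D.domainAlgebra, IsSelfAdjoint ((b : τ.sqIntegrable) : A) →
      (ω b).re ≤ 2 * c * D.normF (D.ofAlgebra b) := by
    intro b hb
    refine le_of_forall_pos_le_add fun ε hε => ?_
    -- Chosen so that `r‖ω‖ ≤ ε`, with `+ 1` covering `ω = 0`.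
    set r : ℝ := ε / (‖ω‖ + 1) with hr
    have hrpos : 0 < r := by positivity
    have hsum := truncAbove_add_excess hrpos.le hb
    obtain ⟨h, hn⟩ := D.exists_normF_truncAbove_le hrpos b hb b.2
    set u : D.domainAlgebra := ⟨⟨_, τ.truncAbove_mem hrpos.le b hb⟩, h⟩ with hu
    have hp : b - u = (⟨excess r ((b : τ.sqIntegrable) : A), τ.excess_mem hrpos.le b hb⟩ :
        τ.sqIntegrable) := Subtype.ext (sub_eq_of_eq_add' hsum.symm)
    have hpD : τ.toL2 ⟨excess r ((b : τ.sqIntegrable) : A), τ.excess_mem hrpos.le b hb⟩ ∈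
        D.domain := by
      rw [← hp]
      exact (b - u).2
    have h1 := hle ⟨excess r ((b : τ.sqIntegrable) : A), τ.excess_mem hrpos.le b hb⟩ hpD
      (subset_closure ⟨_, cfcₙ_nonneg fun t _ => le_max_right _ _, rfl⟩)
    have h2 : (⟨_, hpD⟩ : D.domain) = D.ofAlgebra b - D.ofAlgebra u := by
      rw [← map_sub]
      exact Subtype.ext (congrArg τ.toL2 hp.symm)
    have h3 := D.normF_sub_le (D.ofAlgebra b) (D.ofAlgebra u)
    have h4 : D.normF (D.ofAlgebra u) ≤ D.normF (D.ofAlgebra b) := hn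
    have h5 := re_apply_le hpos hrpos.le (isSelfAdjoint_truncAbove r ((b : τ.sqIntegrable) : A))
      (quasispectrum_truncAbove hrpos.le hb)
    have h6 : r * ‖ω‖ ≤ ε := by
      rw [hr, div_mul_eq_mul_div, div_le_iff₀ (by positivity)]
      nlinarith
    rw [h2] at h1
    have h7 := congrArg (fun a => (ω a).re) hsum
    simp only [_root_.map_add, Complex.add_re] at h7
    have h8 : c * D.normF (D.ofAlgebra b - D.ofAlgebra u) ≤ c * (2 * D.normF (D.ofAlgebra b)) := by
      gcongr
      linarith
    simp only at h1
    linarith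
  refine ⟨2 * c, fun b => ?_⟩
  refine norm_le_of_forall_rotation
    (ω.toLinearMap ∘ₗ τ.sqIntegrable.subtype ∘ₗ D.domainAlgebra.subtype) b fun z hz => ?_
  refine ⟨_, _, D.eq_realPartAlgebra_add (z • b),
    im_apply_eq_zero hpos (D.isSelfAdjoint_realPartAlgebra _),
    im_apply_eq_zero hpos (D.isSelfAdjoint_realPartAlgebra _),
    (key _ (D.isSelfAdjoint_realPartAlgebra _)).trans ?_⟩
  rw [ofAlgebra_realPartAlgebra]
  refine mul_le_mul_of_nonneg_left ?_ (by positivity)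
  refine (D.normF_realPart_le _).trans_eq ?_
  rw [_root_.map_smul, D.normF_smul, hz, one_mul]

theorem IsFiniteEnergy.exists_isPotentialOf (hω : D.IsFiniteEnergy ω) :
    ∃ G : D.domain, D.IsPotentialOf ω G := by
  obtain ⟨C, hC⟩ := hω.exists_bound
  -- `ω` is transported to the image of B in the Dirichlet space, where it is bounded for the graph
  -- norm; Hahn–Banach and the Riesz theorem then produce `G`.
  let j : D.domainAlgebra →ₗ[ℂ] D.DirichletSpace := D.toDirichletSpace.toLinearMap ∘ₗ D.ofAlgebra
  let e := LinearEquiv.ofInjective j (D.toDirichletSpace.injective.comp D.ofAlgebra_injective)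
  let f : StrongDual ℂ (LinearMap.range j) := LinearMap.mkContinuous
    (ω.toLinearMap ∘ₗ τ.sqIntegrable.subtype ∘ₗ D.domainAlgebra.subtype ∘ₗ e.symm.toLinearMap) C
    fun x => by
      obtain ⟨b, rfl⟩ := e.surjective x
      have h := hC b
      rw [← D.norm_toDirichletSpace] at h
      change ‖ω ((e.symm (e b) : τ.sqIntegrable) : A)‖ ≤ _
      rw [LinearEquiv.symm_apply_apply]
      exact h
  obtain ⟨g, hg, -⟩ := exists_extension_norm_eq _ f
  refine ⟨D.toDirichletSpace.symm ((InnerProductSpace.toDual ℂ D.DirichletSpace).symm g),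
    fun b hb => ?_⟩
  have h1 := hg (e ⟨b, hb⟩)
  have h2 : f (e ⟨b, hb⟩) = ω b := by
    change ω ((e.symm (e ⟨b, hb⟩) : τ.sqIntegrable) : A) = _
    rw [LinearEquiv.symm_apply_apply]
  rw [← h2, ← h1, ← InnerProductSpace.toDual_symm_apply]
  rfl

theorem IsPotentialOf.unique {G G' : D.domain} (hG : D.IsPotentialOf ω G)
    (hG' : D.IsPotentialOf ω G') : G = G' := by
  have hd : DenseRange fun b : D.domainAlgebra => D.toDirichletSpace (D.ofAlgebra b) := by
    refine Metric.denseRange_iff.2 fun x r hr => ?_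
    obtain ⟨b, hb, h⟩ := D.regular.2 (D.toDirichletSpace.symm x) r hr
    refine ⟨⟨b, hb⟩, ?_⟩
    rw [dist_eq_norm]
    rw [← D.norm_toDirichletSpace] at h
    exact h
  refine D.toDirichletSpace.injective (hd.eq_of_inner_left (𝕜 := ℂ) fun b => ?_)
  exact (hG b b.2).symm.trans (hG' b b.2)

/-! ### The main estimate. -/

theorem exists_realPart_approx {ξ : D.domain} (hξ : τ.conj ξ = ξ) {ε : ℝ} (hε : 0 < ε) :
    ∃ b : D.domainAlgebra, IsSelfAdjoint ((b : τ.sqIntegrable) : A) ∧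
      D.normF (ξ - D.ofAlgebra b) < ε := by
  obtain ⟨b, hb, h⟩ := D.regular.2 ξ ε hε
  refine ⟨D.realPartAlgebra ⟨b, hb⟩, D.isSelfAdjoint_realPartAlgebra _, ?_⟩
  rw [ofAlgebra_realPartAlgebra, ← D.realPart_of_conj hξ, ← realPart_sub]
  exact (D.normF_realPart_le _).trans_lt h

/-- The main estimate: the potential of a positive functional `ω` is bounded by `r ‖ω‖` on the
elements below `r` of the extended Dirichlet algebra. -/
theorem IsPotentialOf.im_eq_zero_and_re_le (hω : ∀ a : A, 0 ≤ a → 0 ≤ ω a) {G : D.domain}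
    (hG : D.IsPotentialOf ω G) {ξ : D.domain} (hξ : τ.conj ξ = ξ) {r : ℝ} (hr : 0 < r)
    {T : τ.L2 →L[ℂ] τ.L2} (hT : ∀ s : τ.sqIntegrable, T (τ.toL2 s) = τ.rightMul (s : A) ξ)
    (hle : ∀ s : τ.sqIntegrable, (⟪τ.toL2 s, T (τ.toL2 s)⟫_ℂ).re ≤ r * ‖τ.toL2 s‖ ^ 2) :
    (D.innerF G ξ).im = 0 ∧ (D.innerF G ξ).re ≤ r * ‖ω‖ := by
  choose b hb hbξ using fun n : ℕ =>
    exists_realPart_approx hξ (Nat.one_div_pos_of_nat (α := ℝ) (n := n))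
  choose huD hun using fun n => D.exists_normF_truncAbove_le hr (b n) (hb n) (b n).2
  set u : ℕ → D.domain := fun n => ⟨_, huD n⟩ with hu
  have hbn : ∀ n, ‖τ.toL2 (b n) - (ξ : τ.L2)‖ ≤ 1 / ((n : ℝ) + 1) := fun n => by
    rw [norm_sub_rev]
    exact (D.norm_le_normF _).trans (hbξ n).le
  have hbound : ∀ n, D.normF (u n) ≤ D.normF ξ + 1 := fun n => by
    refine (hun n).trans ?_
    change D.normF (D.ofAlgebra (b n)) ≤ _
    have h1 := D.normF_sub_le ξ (ξ - D.ofAlgebra (b n))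
    rw [sub_sub_cancel] at h1
    have h2 : 1 / ((n : ℝ) + 1) ≤ 1 := by
      rw [div_le_one (by positivity)]
      linarith [(Nat.cast_nonneg n : (0 : ℝ) ≤ n)]
    linarith [hbξ n]
  have hlim : Filter.Tendsto (fun n => (u n : τ.L2)) Filter.atTop (nhds (ξ : τ.L2)) := by
    rw [tendsto_iff_norm_sub_tendsto_zero]
    refine squeeze_zero (fun n => norm_nonneg _) (fun n => ?_)
      (by simpa using (tendsto_one_div_add_atTop_nhds_zero_nat (𝕜 := ℝ)).const_mul 2)
    -- As `ξ` lies below `r`, truncating `bₙ` moves it no further than its distance to `ξ`; hence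
    -- the factor `2` in the squeeze.
    have h1 := τ.norm_excess_le hr (b n) (hb n) hT hle
    have h2 : (u n : τ.L2) - ξ = (τ.toL2 (b n) - ξ) - (τ.toL2 (b n) - u n) := by abel
    rw [h2]
    have h3 : ‖τ.toL2 (b n) - (u n : τ.L2)‖ ≤ 1 / ((n : ℝ) + 1) := h1.trans (hbn n)
    refine (norm_sub_le _ _).trans (le_trans (add_le_add (hbn n) h3) (le_of_eq ?_))
    ring
  have hconv := D.tendsto_innerF hbound hlim G
  -- The truncations still belong to B, so the potential equation applies to them.
  have hval : ∀ n, D.innerF G (u n) = ω (truncAbove r ((b n : τ.sqIntegrable) : A)) :=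
    fun n => (hG _ (huD n)).symm
  constructor
  · refine tendsto_nhds_unique ((Complex.continuous_im.tendsto _).comp hconv) ?_
    refine tendsto_const_nhds.congr fun n => ?_
    rw [Function.comp_apply, hval, im_apply_eq_zero hω (isSelfAdjoint_truncAbove _ _)]
  · refine le_of_tendsto ((Complex.continuous_re.tendsto _).comp hconv)
      (Filter.Eventually.of_forall fun n => ?_)
    rw [Function.comp_apply, hval]
    exact re_apply_le hω hr.le (isSelfAdjoint_truncAbove _ _)
      (quasispectrum_truncAbove hr.le (hb n))

end CStarDirichletForm

/-! ### The functional on the extended Dirichlet algebra. -/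

namespace CStarDirichletForm

variable {A : Type*} [NonUnitalCStarAlgebra A] [PartialOrder A] [StarOrderedRing A]
  {τ : CStarTrace A} (D : CStarDirichletForm τ)

/-- The canonical image in the domain of an element of the extended Dirichlet algebra. -/
def symbol (x : D.extendedAlgebra) : D.domain := ⟨x.2.choose, x.2.choose_spec.1⟩

theorem represents_symbol (x : D.extendedAlgebra) :
    τ.Represents (x : τ.L2 →L[ℂ] τ.L2) (D.symbol x) := x.2.choose_spec.2

/-- Uniqueness of the vector makes the choice in `symbol` canonical, hence additive and homogeneous.
-/
theorem symbol_eq {x : D.extendedAlgebra} {ξ : D.domain}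
    (h : τ.Represents (x : τ.L2 →L[ℂ] τ.L2) ξ) : D.symbol x = ξ :=
  Subtype.ext ((D.represents_symbol x).unique h)

/-- The functional `x ↦ ⟨G, x⟩_F` on the extended Dirichlet algebra. -/
def extendedFunctional (G : D.domain) : D.extendedAlgebra →ₗ[ℂ] ℂ where
  toFun x := D.innerF G (D.symbol x)
  map_add' x y := by
    rw [D.symbol_eq (ξ := D.symbol x + D.symbol y)
      ((D.represents_symbol x).add (D.represents_symbol y)), D.innerF_add_right]
  map_smul' z x := by
    rw [D.symbol_eq (ξ := z • D.symbol x) ((D.represents_symbol x).smul z), D.innerF_smul_right]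
    rfl

theorem extendedFunctional_apply (G : D.domain) {x : D.extendedAlgebra} {ξ : D.domain}
    (h : τ.Represents (x : τ.L2 →L[ℂ] τ.L2) ξ) : D.extendedFunctional G x = D.innerF G ξ :=
  congrArg (D.innerF G) (D.symbol_eq h)

theorem star_mem_extendedAlgebra {x : τ.L2 →L[ℂ] τ.L2} (hx : x ∈ D.extendedAlgebra) :
    star x ∈ D.extendedAlgebra := by
  obtain ⟨ξ, hξ, h⟩ := hx
  exact ⟨τ.conj ξ, D.conj_mem hξ, h.adjoint⟩

/-- The real part of an element of the extended Dirichlet algebra. -/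
def realPartExtended (x : D.extendedAlgebra) : D.extendedAlgebra :=
  (1 / 2 : ℂ) • (x + ⟨star (x : τ.L2 →L[ℂ] τ.L2), D.star_mem_extendedAlgebra x.2⟩)

theorem coe_realPartExtended (x : D.extendedAlgebra) :
    (D.realPartExtended x : τ.L2 →L[ℂ] τ.L2) =
      (1 / 2 : ℂ) • ((x : τ.L2 →L[ℂ] τ.L2) + star (x : τ.L2 →L[ℂ] τ.L2)) := rfl

theorem isSelfAdjoint_realPartExtended (x : D.extendedAlgebra) :
    IsSelfAdjoint (D.realPartExtended x : τ.L2 →L[ℂ] τ.L2) := by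
  rw [coe_realPartExtended, IsSelfAdjoint, star_smul, star_add, star_star, add_comm]
  simp

theorem norm_realPartExtended_sub_le (x : D.extendedAlgebra) {y : τ.L2 →L[ℂ] τ.L2}
    (hy : IsSelfAdjoint y) :
    ‖(D.realPartExtended x : τ.L2 →L[ℂ] τ.L2) - y‖ ≤ ‖(x : τ.L2 →L[ℂ] τ.L2) - y‖ := by
  have h : (D.realPartExtended x : τ.L2 →L[ℂ] τ.L2) - y =
      (1 / 2 : ℂ) • (((x : τ.L2 →L[ℂ] τ.L2) - y) + star ((x : τ.L2 →L[ℂ] τ.L2) - y)) := by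
    rw [coe_realPartExtended, star_sub, hy.star_eq]
    module
  rw [h, norm_smul]
  have h1 := norm_add_le ((x : τ.L2 →L[ℂ] τ.L2) - y) (star ((x : τ.L2 →L[ℂ] τ.L2) - y))
  rw [norm_star] at h1
  rw [show ‖(1 / 2 : ℂ)‖ = 1 / 2 by norm_num]
  linarith

theorem eq_realPartExtended_add (x : D.extendedAlgebra) :
    x = D.realPartExtended x + Complex.I • D.realPartExtended (-Complex.I • x) := by
  refine Subtype.ext ?_
  have h : star (-Complex.I • (x : τ.L2 →L[ℂ] τ.L2)) =
      Complex.I • star (x : τ.L2 →L[ℂ] τ.L2) := by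
    rw [star_smul]
    simp
  rw [Submodule.coe_add, Submodule.coe_smul, coe_realPartExtended, coe_realPartExtended,
    Submodule.coe_smul, h, smul_comm Complex.I (1 / 2 : ℂ), ← smul_add, smul_add Complex.I,
    smul_smul, smul_smul]
  simp only [mul_neg, Complex.I_mul_I, neg_neg, one_smul, neg_smul]
  module

variable {D} {ω : StrongDual ℂ A}

theorem IsPotentialOf.extendedFunctional_bound (hω : ∀ a : A, 0 ≤ a → 0 ≤ ω a) {G : D.domain}
    (hG : D.IsPotentialOf ω G) {x : D.extendedAlgebra}
    (hx : IsSelfAdjoint (x : τ.L2 →L[ℂ] τ.L2)) {r : ℝ} (hr : 0 < r)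
    (hle : ∀ η : τ.L2, (⟪η, (x : τ.L2 →L[ℂ] τ.L2) η⟫_ℂ).re ≤ r * ‖η‖ ^ 2) :
    (D.extendedFunctional G x).im = 0 ∧ (D.extendedFunctional G x).re ≤ r * ‖ω‖ := by
  have h := D.represents_symbol x
  have h' := h.adjoint
  rw [hx.star_eq] at h'
  exact hG.im_eq_zero_and_re_le hω (h'.unique h) hr h.2 fun s => hle _

theorem re_inner_apply_le (x : τ.L2 →L[ℂ] τ.L2) (η : τ.L2) :
    (⟪η, x η⟫_ℂ).re ≤ ‖x‖ * ‖η‖ ^ 2 := by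
  refine (Complex.re_le_norm _).trans ((norm_inner_le_norm _ _).trans ?_)
  nlinarith [x.le_opNorm η, norm_nonneg η]

theorem IsPotentialOf.norm_extendedFunctional_le (hω : ∀ a : A, 0 ≤ a → 0 ≤ ω a) {G : D.domain}
    (hG : D.IsPotentialOf ω G) (x : D.extendedAlgebra) :
    ‖D.extendedFunctional G x‖ ≤ ‖ω‖ * ‖x‖ := by
  -- The margin `δ` is there because the main estimate needs a strictly positive height, even for `y
  -- = 0`.
  have key : ∀ y : D.extendedAlgebra, IsSelfAdjoint (y : τ.L2 →L[ℂ] τ.L2) → ∀ δ > 0,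
      (D.extendedFunctional G y).im = 0 ∧ (D.extendedFunctional G y).re ≤ (‖y‖ + δ) * ‖ω‖ := by
    intro y hy δ hδ
    refine hG.extendedFunctional_bound hω hy (by positivity) fun η => ?_
    refine (re_inner_apply_le _ η).trans ?_
    rw [Submodule.coe_norm]
    gcongr
    linarith
  refine norm_le_of_forall_rotation _ x fun z hz => ?_
  refine ⟨_, _, D.eq_realPartExtended_add (z • x),
    (key _ (D.isSelfAdjoint_realPartExtended _) 1 one_pos).1,
    (key _ (D.isSelfAdjoint_realPartExtended _) 1 one_pos).1, ?_⟩
  refine le_of_forall_pos_le_add fun ε hε => ?_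
  have h1 := (key _ (D.isSelfAdjoint_realPartExtended (z • x)) (ε / (‖ω‖ + 1))
    (by positivity)).2
  have h2 := D.norm_realPartExtended_sub_le (z • x) (IsSelfAdjoint.zero _)
  rw [sub_zero, sub_zero, Submodule.coe_smul, norm_smul, hz, one_mul] at h2
  have h3 : ε / (‖ω‖ + 1) * ‖ω‖ ≤ ε := by
    rw [div_mul_eq_mul_div, div_le_iff₀ (by positivity)]
    nlinarith [norm_nonneg ω]
  have h4 := mul_le_mul_of_nonneg_right h2 (norm_nonneg ω)
  rw [add_mul] at h1
  simp only [Submodule.coe_norm] at h1 ⊢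
  linarith

variable (D) in
theorem gns_mem_extendedAlgebra (b : D.domainAlgebra) :
    τ.gns ((b : τ.sqIntegrable) : A) ∈ D.extendedAlgebra :=
  ⟨τ.toL2 b, b.2, τ.represents_gns b⟩

variable (D) in
theorem exists_domainAlgebra_approx (a : A) {ε : ℝ} (hε : 0 < ε) :
    ∃ b : D.domainAlgebra, ‖a - ((b : τ.sqIntegrable) : A)‖ < ε := by
  obtain ⟨_, ⟨b, hb, rfl⟩, h⟩ := Metric.mem_closure_iff.1 (D.regular.1 a) ε hε
  rw [dist_eq_norm] at h
  exact ⟨⟨b, hb⟩, h⟩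

variable (D) in
theorem gns_mem_fine (a : A) : τ.gns a ∈ D.fine := by
  refine Metric.mem_closure_iff.2 fun ε hε => ?_
  obtain ⟨b, hb⟩ := D.exists_domainAlgebra_approx a hε
  refine ⟨_, D.gns_mem_extendedAlgebra b, ?_⟩
  rw [dist_eq_norm, ← τ.gns_sub]
  exact (τ.norm_gns_le _).trans_lt hb

/-! ### Extension, restriction to A and positivity. -/

/-- Hahn–Banach extends to all bounded operators; on the fine algebra the values are forced by
density. -/
theorem IsPotentialOf.exists_extension (hω : ∀ a : A, 0 ≤ a → 0 ≤ ω a) {G : D.domain}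
    (hG : D.IsPotentialOf ω G) :
    ∃ Ω : StrongDual ℂ (τ.L2 →L[ℂ] τ.L2),
      (∀ x : D.extendedAlgebra, Ω x = D.extendedFunctional G x) ∧ ‖Ω‖ ≤ ‖ω‖ := by
  obtain ⟨Ω, h, hn⟩ := exists_extension_norm_eq _
    ((D.extendedFunctional G).mkContinuous ‖ω‖ (hG.norm_extendedFunctional_le hω))
  exact ⟨Ω, h, hn.trans_le (LinearMap.mkContinuous_norm_le _ (norm_nonneg _) _)⟩

theorem IsPotentialOf.extension_gns {G : D.domain} (hG : D.IsPotentialOf ω G)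
    {Ω : StrongDual ℂ (τ.L2 →L[ℂ] τ.L2)}
    (hΩ : ∀ x : D.extendedAlgebra, Ω x = D.extendedFunctional G x) (a : A) :
    Ω (τ.gns a) = ω a := by
  rw [← sub_eq_zero, ← norm_le_zero_iff]
  refine le_of_forall_pos_le_add fun ε hε => ?_
  obtain ⟨b, hb⟩ := D.exists_domainAlgebra_approx a (ε := ε / (‖Ω‖ + ‖ω‖ + 1)) (by positivity)
  have h1 : Ω (τ.gns ((b : τ.sqIntegrable) : A)) = ω b := by
    rw [hG b b.2]
    exact (hΩ ⟨_, D.gns_mem_extendedAlgebra b⟩).trans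
      (D.extendedFunctional_apply G (ξ := D.ofAlgebra b) (τ.represents_gns b))
  have h2 : Ω (τ.gns a) - ω a = Ω (τ.gns (a - ((b : τ.sqIntegrable) : A))) -
      ω (a - ((b : τ.sqIntegrable) : A)) := by
    rw [τ.gns_sub, map_sub, map_sub, h1]
    ring
  rw [lt_div_iff₀ (by positivity)] at hb
  rw [h2]
  have h3 := Ω.le_opNorm (τ.gns (a - ((b : τ.sqIntegrable) : A)))
  have h4 := ω.le_opNorm (a - ((b : τ.sqIntegrable) : A))
  have h5 := mul_le_mul_of_nonneg_left (τ.norm_gns_le (a - ((b : τ.sqIntegrable) : A)))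
    (norm_nonneg Ω)
  refine (norm_sub_le _ _).trans ?_
  nlinarith [norm_nonneg (a - ((b : τ.sqIntegrable) : A))]

/-- No positive approximants are needed. If a self-adjoint `y` in B̃ is within `δ` of `x ≥ 0`, then
`-y = (x - y) - x ≤ δ`, and the main estimate for `-y` gives `Re Ω(y) ≥ -δ‖ω‖`. -/
theorem IsPotentialOf.extension_nonneg (hω : ∀ a : A, 0 ≤ a → 0 ≤ ω a) {G : D.domain}
    (hG : D.IsPotentialOf ω G) {Ω : StrongDual ℂ (τ.L2 →L[ℂ] τ.L2)}
    (hΩ : ∀ x : D.extendedAlgebra, Ω x = D.extendedFunctional G x) {x : τ.L2 →L[ℂ] τ.L2}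
    (hx : x ∈ D.fine) (hpos : x.IsPositive) : 0 ≤ Ω x := by
  have key : ∀ ε > 0, -ε ≤ (Ω x).re ∧ |(Ω x).im| ≤ ε := by
    intro ε hε
    set δ : ℝ := ε / (‖Ω‖ + ‖ω‖ + 1) with hδ
    have hδpos : 0 < δ := by positivity
    have hδε : δ * ‖Ω‖ + δ * ‖ω‖ ≤ ε := by
      rw [← mul_add, hδ, div_mul_eq_mul_div, div_le_iff₀ (by positivity)]
      nlinarith
    obtain ⟨y', hy', hxy'⟩ := Metric.mem_closure_iff.1 hx δ hδpos
    have hsa : IsSelfAdjoint x := hpos.isSelfAdjoint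
    set y := D.realPartExtended ⟨y', hy'⟩ with hy
    have hxy : ‖(y : τ.L2 →L[ℂ] τ.L2) - x‖ < δ := by
      refine (D.norm_realPartExtended_sub_le ⟨y', hy'⟩ hsa).trans_lt ?_
      rwa [dist_eq_norm, norm_sub_rev] at hxy'
    obtain ⟨h1, h2⟩ := hG.extendedFunctional_bound hω (x := -y)
      (D.isSelfAdjoint_realPartExtended _).neg hδpos fun η => by
        have h3 := re_inner_apply_le (x - (y : τ.L2 →L[ℂ] τ.L2)) η
        have h4 : 0 ≤ (⟪η, x η⟫_ℂ).re := hpos.re_inner_nonneg_right η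
        rw [sub_apply, inner_sub_right, Complex.sub_re, norm_sub_rev] at h3
        rw [Submodule.coe_neg, neg_apply, inner_neg_right, Complex.neg_re]
        have h5 := mul_le_mul_of_nonneg_right hxy.le (sq_nonneg ‖η‖)
        linarith
    rw [map_neg, ← hΩ, Complex.neg_re, Complex.neg_im] at *
    have h6 := Ω.le_opNorm ((y : τ.L2 →L[ℂ] τ.L2) - x)
    have h7 : ‖Ω ((y : τ.L2 →L[ℂ] τ.L2) - x)‖ ≤ δ * ‖Ω‖ := by
      nlinarith [norm_nonneg Ω]
    have h8 := (Complex.abs_re_le_norm _).trans h7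
    have h9 := (Complex.abs_im_le_norm _).trans h7
    rw [map_sub, Complex.sub_re] at h8
    rw [map_sub, Complex.sub_im, neg_eq_zero.1 h1, zero_sub, abs_neg] at h9
    have h10 : 0 ≤ δ * ‖ω‖ := by positivity
    exact ⟨by linarith [(abs_le.1 h8).2], by linarith⟩
  refine Complex.nonneg_iff.2 ⟨?_, ?_⟩
  · exact le_of_forall_pos_le_add fun ε hε => by linarith [(key ε hε).1]
  · refine (abs_nonpos_iff.1 (le_of_forall_pos_le_add fun ε hε => ?_)).symm
    linarith [(key ε hε).2]

end CStarDirichletForm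

end

theorem proposition3p5 {A : Type*} [NonUnitalCStarAlgebra A] [PartialOrder A] [StarOrderedRing A]
    [TopologicalSpace.SeparableSpace A] (τ : CStarTrace A) (D : CStarDirichletForm τ)
    (ω : StrongDual ℂ A) (hω : D.IsFiniteEnergy ω) :
    (∃! G : D.domain, D.IsPotentialOf ω G) ∧
    ∀ G : D.domain, D.IsPotentialOf ω G →
      ∃ Ω : StrongDual ℂ D.fine,
        (∀ (x : D.fine) (ξ : D.domain),
          τ.Represents (x : τ.L2 →L[ℂ] τ.L2) (ξ : τ.L2) → Ω x = D.innerF G ξ) ∧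
        (∀ a : A, ∃ h : τ.gns a ∈ D.fine, Ω ⟨τ.gns a, h⟩ = ω a) ∧
        (∀ x : D.fine, (x : τ.L2 →L[ℂ] τ.L2).IsPositive → 0 ≤ Ω x) ∧
        ‖Ω‖ = ‖ω‖ := by
  refine ⟨?_, fun G hG => ?_⟩
  · obtain ⟨G, hG⟩ := hω.exists_isPotentialOf
    exact ⟨G, hG, fun G' hG' => hG'.unique hG⟩
  · obtain ⟨Ω, hΩ, hn⟩ := hG.exists_extension hω.1
    have hgns := hG.extension_gns hΩ
    refine ⟨Ω.comp D.fine.subtypeL, fun x ξ h => ?_, fun a => ⟨D.gns_mem_fine a, hgns a⟩,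
      fun x hx => hG.extension_nonneg hω.1 hΩ x.2 hx, le_antisymm ?_ ?_⟩
    · exact (hΩ ⟨x, ξ, ξ.2, h⟩).trans (D.extendedFunctional_apply G h)
    · refine ContinuousLinearMap.opNorm_le_bound _ (norm_nonneg _) fun x => ?_
      exact (Ω.le_opNorm x).trans (mul_le_mul_of_nonneg_right hn (norm_nonneg _))
    -- `ω` is the extension composed with the contraction `π_τ`; no isometry is required.
    · refine ContinuousLinearMap.opNorm_le_bound _ (ContinuousLinearMap.opNorm_nonneg _) fun a => ?_
      have h := (Ω.comp D.fine.subtypeL).le_opNorm ⟨τ.gns a, D.gns_mem_fine a⟩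
      have h' : (Ω.comp D.fine.subtypeL) ⟨τ.gns a, D.gns_mem_fine a⟩ = ω a := hgns a
      rw [h'] at h
      exact h.trans (mul_le_mul_of_nonneg_left (τ.norm_gns_le a)
        (ContinuousLinearMap.opNorm_nonneg _))
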